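/- Let $n\ge 1$ and let $\mathfrak S_n$ be the symmetric group on $\{1,\dots,n\}$, with $\ell(\sigma)$ denoting the number of cycles of $\sigma\in\mathfrak S_n$, fixed points included. A \emph{cycle factorization} of $\pi\in\mathfrak S_n$ is a tuple $F=(\sigma_r,\dots,\sigma_1)$ of cycles of length at least two in $\mathfrak S_n$ such that $\pi=\sigma_r\cdots\sigma_1$, the group $\langle\sigma_1,\dots,\sigma_r\rangle$ acts transitively on $\{1,\dots,n\}$, and $nr-\sum_{j=1}^r\ell(\sigma_j)=n+\ell(\pi)-2$ (that is, the factorization is minimal transitive). Its \emph{cycle index} is the sequence $(i_2,i_3,\dots)$, where $i_k$ is the number of factors that are $k$-cycles. Two cycle factorizations are \emph{equivalent} if one can be obtained from the other by repeatedly exchanging adjacent factors that are disjoint, in the sense that no symbol is moved by both. \textbf{Theorem (Springer).} Let $\vec i=(i_2,i_3,\dots)$ be a sequence of nonnegative integers with finitely many nonzero terms, and set $r=i_2+i_3+\cdots$. Then the number of equivalence classes of cycle factorizations of $(1\,2\,\cdots\,n)$ with cycle index $\vec i$ is finite and equals $$\frac{(2n+r-2)!}{(2n-1)!\,\prod_{k\ge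 2} i_k!}$$ if $n+r-1=\sum_{k\ge 2} k\,i_k$, and $0$ otherwise. -/

import Mathlib

namespace CycleFactorization

/-- The number of cycles of a permutation of a finite set, fixed points included. -/
def numCycles {n : ℕ} (σ : Equiv.Perm (Fin n)) : ℕ :=
  σ.partition.parts.card

/-- `F = [σ_r, …, σ_1]` is a transitive factorization of `π`: `π = σ_r ⋯ σ_1`, and the group
generated by the factors acts transitively on the `n` symbols. -/
structure IsTransitiveFactorization {n : ℕ} (π : Equiv.Perm (Fin n))
    (F : List (Equiv.Perm (Fin n))) : Prop where
  prod_eq : F.prod = π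
  transitive : MulAction.IsPretransitive (Subgroup.closure {σ | σ ∈ F}) (Fin n)

/-- A transitive factorization with `n r - ∑ ℓ(σ_j) = n + ℓ(π) - 2`, where `ℓ` is the number of
cycles. -/
structure IsMinimalTransitive {n : ℕ} (π : Equiv.Perm (Fin n))
    (F : List (Equiv.Perm (Fin n))) : Prop extends IsTransitiveFactorization π F where
  minimal : (n : ℤ) * F.length - ((F.map numCycles).sum : ℕ) = n + numCycles π - 2

/-- A minimal transitive factorization all of whose factors are cycles of length at least two
(`Equiv.Perm.IsCycle` excludes the identity). -/
structure IsCycleFactorization {n : ℕ} (π : Equiv.Perm (Fin n))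
    (F : List (Equiv.Perm (Fin n))) : Prop extends IsMinimalTransitive π F where
  isCycle : ∀ σ ∈ F, σ.IsCycle

/-- `σ` is a `k`-cycle. -/
def IsKCycle {n : ℕ} (k : ℕ) (σ : Equiv.Perm (Fin n)) : Prop :=
  σ.IsCycle ∧ σ.support.card = k

open Classical in
/-- `F` has cycle index `(i 2, i 3, …)`: for every `k ≥ 2`, exactly `i k` factors are
`k`-cycles. -/
def HasCycleIndex {n : ℕ} (F : List (Equiv.Perm (Fin n))) (i : ℕ →₀ ℕ) : Prop :=
  ∀ k, 2 ≤ k → F.countP (fun σ => decide (IsKCycle k σ)) = i k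

/-- One exchange of two adjacent disjoint factors (no symbol is moved by both). -/
inductive Exchange {n : ℕ} :
    List (Equiv.Perm (Fin n)) → List (Equiv.Perm (Fin n)) → Prop
  | mk (L R : List (Equiv.Perm (Fin n))) (σ τ : Equiv.Perm (Fin n)) (h : σ.Disjoint τ) :
      Exchange (L ++ σ :: τ :: R) (L ++ τ :: σ :: R)

/-- One tuple is obtained from the other by finitely many exchanges. -/
def Equivalent {n : ℕ} (F G : List (Equiv.Perm (Fin n))) : Prop :=
  Relation.ReflTransGen Exchange F G

theorem exchange_symm {n : ℕ} {F G : List (Equiv.Perm (Fin n))} (h : Exchange F G) :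
    Exchange G F := by
  obtain ⟨L, R, σ, τ, h⟩ := h
  exact Exchange.mk L R τ σ h.symm

theorem equivalent_symm {n : ℕ} {F G : List (Equiv.Perm (Fin n))} (h : Equivalent F G) :
    Equivalent G F := by
  induction h with
  | refl => exact Relation.ReflTransGen.refl
  | tail _ hbc ih => exact Relation.ReflTransGen.head (exchange_symm hbc) ih

/-- The cycle factorizations of `π` with cycle index `i`. -/
def Factorizations {n : ℕ} (π : Equiv.Perm (Fin n)) (i : ℕ →₀ ℕ) : Type :=
  {F : List (Equiv.Perm (Fin n)) // IsCycleFactorization π F ∧ HasCycleIndex F i}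

/-- Equivalence of cycle factorizations of `π` with cycle index `i` up to exchanges of adjacent
disjoint factors. -/
instance factorizationSetoid {n : ℕ} (π : Equiv.Perm (Fin n)) (i : ℕ →₀ ℕ) :
    Setoid (Factorizations π i) where
  r F G := Equivalent F.1 G.1
  iseqv :=
    { refl := fun _ => Relation.ReflTransGen.refl
      symm := fun h => equivalent_symm h
      trans := fun h h' => Relation.ReflTransGen.trans h h' }

/-- The equivalence classes of cycle factorizations of `π` with cycle index `i`. -/
def Classes {n : ℕ} (π : Equiv.Perm (Fin n)) (i : ℕ →₀ ℕ) : Type :=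
  Quotient (factorizationSetoid π i)

end CycleFactorization

/-! Give a `k`-cycle the weight `k - 1`. A minimal transitive cycle factorization of the full cycle
is then a factorization into cycles of total weight `n - 1`, the least possible. Minimality is
exploited by linear algebra: invariance under `σ` costs a rational function at most `weight σ`
dimensions, and if the weights add up exactly, functions invariant under the product are invariant
under every factor (`IsReduced.commonInvariants_eq`). So each factor preserves every set that the
product preserves. Splitting one factor by a transposition cuts the cycle of the product in two,
which makes this applicable to arcs of the cycle.

First consequence: if two factors move `a`, the one applied first carries it less far round the
cycle (`IsIntervalFactorization.apply_mem_arc`). The relative order of non-disjoint factors is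
therefore forced by the factors themselves, and an equivalence class is a multiset of factors.

Second consequence: factorizations decompose. Take the leftmost factor that moves the root `s` and
remove its vertices one at a time, last one first. Removing `a` rests on the identity `(s … t) =
(p+1 … a) · (s a) · (a … t) · (s … p)` and splits off minimal factorizations of `(p+1 … a)` and `(a
… t)` (`IsMarked.cut`). When the polygon is used up, a factorization of an initial interval with
root `s` is left. Recursively this gives a plane tree, in which a `(j+2)`-cycle is a node with
`2(j+1) + 1 = 2j + 3` children. The encoding is onto (`IsMarked.exists_cactus`) and injective even
on multisets of factors (`Cactus.eq_of_eval_perm`).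

Finally, trees are read as Łukasiewicz words, which are counted by their first letter
(`card_words`). A single tree here has `2(n-1) + 1` leaves and `r` inner nodes, which gives the
formula. -/

namespace CycleFactorization

open Equiv Module

set_option linter.unusedSectionVars false

/-! ### Weights, invariant functions and reduced lists -/

section Reduced

variable {α : Type*} [Fintype α] [DecidableEq α]

/-- The length of a `k`-cycle as a product of transpositions; `0` for the identity. -/
def weight (σ : Perm α) : ℕ := σ.support.card - 1

/-- The total weight of a list of permutations. -/
def weightSum (F : List (Perm α)) : ℕ := (F.map weight).sum

@[simp] theorem weight_one : weight (1 : Perm α) = 0 := by simp [weight]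

@[simp] theorem weightSum_nil : weightSum ([] : List (Perm α)) = 0 := rfl

@[simp] theorem weightSum_cons (σ : Perm α) (F : List (Perm α)) :
    weightSum (σ :: F) = weight σ + weightSum F := by simp [weightSum]

@[simp] theorem weightSum_append (F G : List (Perm α)) :
    weightSum (F ++ G) = weightSum F + weightSum G := by simp [weightSum]

theorem weightSum_perm {F G : List (Perm α)} (h : F.Perm G) : weightSum F = weightSum G :=
  (h.map weight).sum_eq

theorem weight_conj (σ τ : Perm α) : weight (τ * σ * τ⁻¹) = weight σ := by
  simp [weight]

theorem weightSum_map_conj (τ : Perm α) (F : List (Perm α)) :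
    weightSum (F.map fun σ => τ * σ * τ⁻¹) = weightSum F := by
  induction F with
  | nil => rfl
  | cons σ F ih => simp [ih, weight_conj]

theorem prod_map_conj (τ : Perm α) (F : List (Perm α)) :
    (F.map fun σ => τ * σ * τ⁻¹).prod = τ * F.prod * τ⁻¹ := by
  induction F with
  | nil => simp
  | cons σ F ih => simp [ih]

/-- The rational functions invariant under a permutation. -/
def invariants (σ : Perm α) : Submodule ℚ (α → ℚ) where
  carrier := {f | ∀ x, f (σ x) = f x}
  add_mem' := by intro f g hf hg x; simp [hf x, hg x]
  zero_mem' := by intro x; simp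
  smul_mem' := by intro c f hf x; simp [hf x]

/-- The rational functions invariant under all members of a list of permutations. -/
def commonInvariants (F : List (Perm α)) : Submodule ℚ (α → ℚ) where
  carrier := {f | ∀ σ ∈ F, ∀ x, f (σ x) = f x}
  add_mem' := by intro f g hf hg σ hσ x; simp [hf σ hσ x, hg σ hσ x]
  zero_mem' := by intro σ _ x; simp
  smul_mem' := by intro c f hf σ hσ x; simp [hf σ hσ x]

theorem mem_invariants {σ : Perm α} {f : α → ℚ} : f ∈ invariants σ ↔ ∀ x, f (σ x) = f x :=
  Iff.rfl

theorem mem_commonInvariants {F : List (Perm α)} {f : α → ℚ} :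
    f ∈ commonInvariants F ↔ ∀ σ ∈ F, ∀ x, f (σ x) = f x :=
  Iff.rfl

/-- Being constant on the support takes `weight σ` linear conditions and suffices for invariance.
For a cycle this is sharp; for other permutations only the inequality is needed. -/
theorem card_le_weight_add_finrank (σ : Perm α) :
    Fintype.card α ≤ weight σ + finrank ℚ (invariants σ) := by
  rcases eq_or_ne σ 1 with rfl | hσ
  · have : invariants (1 : Perm α) = ⊤ := by
      ext f; simp [mem_invariants]
    rw [this, finrank_top, finrank_fintype_fun_eq_card]
    exact Nat.le_add_left _ _
  · obtain ⟨a, ha⟩ : σ.support.Nonempty := by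
      rw [Finset.nonempty_iff_ne_empty, Ne, Perm.support_eq_empty_iff]; exact hσ
    let φ : (α → ℚ) →ₗ[ℚ] ({x // x ∈ σ.support.erase a} → ℚ) :=
      LinearMap.pi fun x =>
        LinearMap.proj (R := ℚ) (φ := fun _ => ℚ) (x : α) - LinearMap.proj a
    have hk : LinearMap.ker φ ≤ invariants σ := by
      intro f hf
      have hc : ∀ x ∈ σ.support, f x = f a := by
        intro x hx
        by_cases hxa : x = a
        · rw [hxa]
        · have := congrFun (LinearMap.mem_ker.1 hf) ⟨x, Finset.mem_erase.2 ⟨hxa, hx⟩⟩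
          simpa [φ, sub_eq_zero] using this
      intro x
      by_cases hx : x ∈ σ.support
      · rw [hc x hx, hc _ (Perm.apply_mem_support.2 hx)]
      · rw [Perm.notMem_support.1 hx]
    have h1 := LinearMap.finrank_range_add_finrank_ker φ
    have h2 : finrank ℚ (LinearMap.range φ) ≤ weight σ := by
      refine (Submodule.finrank_le _).trans ?_
      rw [finrank_fintype_fun_eq_card, Fintype.card_coe, Finset.card_erase_of_mem ha]
      rfl
    have h3 := Submodule.finrank_mono hk
    rw [finrank_fintype_fun_eq_card] at h1
    omega

theorem finrank_add_le_finrank_inf (V W : Submodule ℚ (α → ℚ)) :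
    finrank ℚ V + finrank ℚ W ≤ Fintype.card α + finrank ℚ (V ⊓ W : Submodule ℚ (α → ℚ)) := by
  have h := Submodule.finrank_sup_add_finrank_inf_eq V W
  have h2 := Submodule.finrank_le (V ⊔ W)
  rw [finrank_fintype_fun_eq_card] at h2
  omega

theorem card_le_weightSum_add_finrank_common (F : List (Perm α)) :
    Fintype.card α ≤ weightSum F + finrank ℚ (commonInvariants F) := by
  induction F with
  | nil =>
    have : commonInvariants ([] : List (Perm α)) = ⊤ := by
      ext f; simp [mem_commonInvariants]
    rw [this, finrank_top, finrank_fintype_fun_eq_card]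
    exact Nat.le_add_left _ _
  | cons σ F ih =>
    have h : commonInvariants (σ :: F) = invariants σ ⊓ commonInvariants F := by
      ext f; simp [mem_commonInvariants, mem_invariants]
    have h1 := card_le_weight_add_finrank σ
    have h2 := finrank_add_le_finrank_inf (invariants σ) (commonInvariants F)
    rw [h, weightSum_cons]
    omega

theorem commonInvariants_le (F : List (Perm α)) : commonInvariants F ≤ invariants F.prod := by
  induction F with
  | nil => intro f _ x; simp
  | cons σ F ih =>
    intro f hf x
    rw [List.prod_cons, Perm.mul_apply, hf σ (by simp)]
    exact ih (fun τ hτ => hf τ (by simp [hτ])) x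

/-- A list of permutations is reduced if its total weight is as small as its product allows. -/
def IsReduced (F : List (Perm α)) : Prop :=
  weightSum F + finrank ℚ (invariants F.prod) ≤ Fintype.card α

theorem card_le_weightSum_add_finrank (F : List (Perm α)) :
    Fintype.card α ≤ weightSum F + finrank ℚ (invariants F.prod) :=
  (card_le_weightSum_add_finrank_common F).trans
    (Nat.add_le_add_left (Submodule.finrank_mono (commonInvariants_le F)) _)

/-- The common invariants have dimension at least `card α - weightSum F`, which for a reduced list
is at least the dimension of the larger space. -/
theorem IsReduced.commonInvariants_eq {F : List (Perm α)} (h : IsReduced F) :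
    commonInvariants F = invariants F.prod := by
  refine Submodule.eq_of_le_of_finrank_le (commonInvariants_le F) ?_
  have := card_le_weightSum_add_finrank_common F
  unfold IsReduced at h
  omega

/-- The members of a reduced list preserve every set that the product preserves. -/
theorem IsReduced.mem_iff {F : List (Perm α)} (h : IsReduced F) (p : α → Prop)
    (hp : ∀ x, p (F.prod x) ↔ p x) {σ : Perm α} (hσ : σ ∈ F) (x : α) : p (σ x) ↔ p x := by
  classical
  -- A set is preserved exactly when its indicator function is invariant.
  have hf : (fun x => if p x then (1 : ℚ) else 0) ∈ invariants F.prod := by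
    intro x; simp [hp x]
  rw [← h.commonInvariants_eq] at hf
  have := hf σ hσ x
  by_cases h1 : p (σ x) <;> by_cases h2 : p x <;> simp_all

theorem finrank_invariants_le {π : Perm α} (R : Finset α)
    (h : ∀ f ∈ invariants π, (∀ x ∈ R, f x = 0) → f = 0) :
    finrank ℚ (invariants π) ≤ R.card := by
  let φ : invariants π →ₗ[ℚ] ({x // x ∈ R} → ℚ) :=
    (LinearMap.pi fun x => LinearMap.proj (R := ℚ) (φ := fun _ => ℚ) (x : α)) ∘ₗ (invariants π).subtype
  have hφ : Function.Injective φ := by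
    rw [← LinearMap.ker_eq_bot, LinearMap.ker_eq_bot']
    intro f hf
    refine Subtype.ext (h f f.2 fun x hx => ?_)
    exact congrFun hf ⟨x, hx⟩
  have := LinearMap.finrank_le_finrank_of_injective hφ
  rwa [finrank_fintype_fun_eq_card, Fintype.card_coe] at this

/-- On functions with `f a = f b`, a single linear condition, the transposition has no effect. -/
theorem finrank_invariants_swap_mul_le (a b : α) (π : Perm α) :
    finrank ℚ (invariants (swap a b * π)) ≤ finrank ℚ (invariants π) + 1 := by
  let φ : (α → ℚ) →ₗ[ℚ] ℚ := LinearMap.proj (R := ℚ) (φ := fun _ => ℚ) a - LinearMap.proj b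
  have h1 := LinearMap.finrank_range_add_finrank_ker φ
  have h2 := Submodule.finrank_le (LinearMap.range φ)
  rw [finrank_fintype_fun_eq_card] at h1
  rw [finrank_self] at h2
  have h3 := finrank_add_le_finrank_inf (invariants (swap a b * π)) (LinearMap.ker φ)
  have h4 : invariants (swap a b * π) ⊓ LinearMap.ker φ ≤ invariants π := by
    rintro f ⟨hf, hφ⟩ x
    have hab : f a = f b := by
      simpa [φ, sub_eq_zero] using hφ
    have hs : ∀ y, f (swap a b y) = f y := by
      intro y
      rw [swap_apply_def]
      split_ifs with h h' <;> simp_all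
    rw [← hf x, Perm.mul_apply, hs]
  have h5 := Submodule.finrank_mono h4
  omega

/-- Carried past `X`, the transposition multiplies the whole product by a transposition, so the
invariants gain at most one dimension, while the weight drops by at least one. -/
theorem IsReduced.swap_mul {X Y : List (Perm α)} {σ : Perm α} (h : IsReduced (X ++ σ :: Y))
    (a b : α) (hw : weight (swap a b * σ) + 1 ≤ weight σ) :
    IsReduced (X ++ (swap a b * σ) :: Y) := by
  have hp : (X ++ (swap a b * σ) :: Y).prod =
      swap (X.prod a) (X.prod b) * (X ++ σ :: Y).prod := by
    have : swap (X.prod a) (X.prod b) = X.prod * swap a b * X.prod⁻¹ := by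
      rw [mul_swap_eq_swap_mul, mul_inv_cancel_right]
    rw [this]
    simp [mul_assoc]
  unfold IsReduced at *
  rw [hp]
  have := finrank_invariants_swap_mul_le (X.prod a) (X.prod b) (X ++ σ :: Y).prod
  simp only [weightSum_append, weightSum_cons] at *
  omega

theorem weight_swap_mul_lt {σ : Perm α} {a : α} (ha : σ a ≠ a) :
    weight (swap a (σ a) * σ) + 1 ≤ weight σ := by
  have h := Perm.card_support_swap_mul ha
  have h2 := Perm.two_le_card_support_of_ne_one (f := σ) (by rintro rfl; exact ha rfl)
  unfold weight
  omega

end Reduced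

/-! ### Minimal factorizations of interval cycles -/

variable {N : ℕ}

/-- `π` is the cycle `(s s+1 … t)`. -/
def IsIntervalCycle (s t : ℕ) (π : Perm (Fin N)) : Prop :=
  ∀ x : Fin N, (π x : ℕ) =
    if (x : ℕ) = t then s else if s ≤ (x : ℕ) ∧ (x : ℕ) < t then (x : ℕ) + 1 else x

/-- `F` is a factorization of the cycle `(s s+1 … t)` of minimal weight. -/
structure IsIntervalFactorization (s t : ℕ) (F : List (Perm (Fin N))) : Prop where
  le : s ≤ t
  lt : t < N
  prod : IsIntervalCycle s t F.prod
  weight : weightSum F + s = t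

/-- `σ` moves only points of the interval `[s, t]`. -/
def Within (s t : ℕ) (σ : Perm (Fin N)) : Prop :=
  ∀ x : Fin N, (x : ℕ) < s ∨ t < (x : ℕ) → σ x = x

theorem Within.mem_iff {s t : ℕ} {σ : Perm (Fin N)} (h : Within s t σ) (x : Fin N) :
    (s ≤ (σ x : ℕ) ∧ (σ x : ℕ) ≤ t) ↔ (s ≤ (x : ℕ) ∧ (x : ℕ) ≤ t) := by
  by_cases hx : s ≤ (x : ℕ) ∧ (x : ℕ) ≤ t
  · refine iff_of_true ?_ hx
    by_contra hc
    have h1 : σ (σ x) = σ x := h _ (by omega)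
    rw [σ.injective h1] at hc
    exact hc hx
  · rw [h x (by omega)]

theorem Within.mono {s t s' t' : ℕ} {σ : Perm (Fin N)} (h : Within s t σ) (hs : s' ≤ s)
    (ht : t ≤ t') : Within s' t' σ :=
  fun x hx => h x (by omega)

theorem Within.one (s t : ℕ) : Within s t (1 : Perm (Fin N)) := fun _ _ => rfl

theorem Within.mul {s t : ℕ} {σ τ : Perm (Fin N)} (h : Within s t σ) (h' : Within s t τ) :
    Within s t (σ * τ) := fun x hx => by
  rw [Perm.mul_apply, h' x hx, h x hx]

theorem Within.list_prod {s t : ℕ} {F : List (Perm (Fin N))} (h : ∀ σ ∈ F, Within s t σ) :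
    Within s t F.prod := by
  induction F with
  | nil => exact Within.one s t
  | cons σ F ih =>
    rw [List.prod_cons]
    exact (h σ (by simp)).mul (ih fun τ hτ => h τ (by simp [hτ]))

theorem Within.disjoint {s t s' t' : ℕ} {σ τ : Perm (Fin N)} (h : Within s t σ)
    (h' : Within s' t' τ) (ht : t < s') : σ.Disjoint τ := fun x => by
  by_cases hx : (x : ℕ) ≤ t
  · exact Or.inr (h' x (by omega))
  · exact Or.inl (h x (by omega))

theorem IsIntervalCycle.within {s t : ℕ} {π : Perm (Fin N)} (h : IsIntervalCycle s t π)
    (hst : s ≤ t) : Within s t π := fun x hx => by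
  have := h x
  rw [if_neg (by omega), if_neg (by omega)] at this
  exact Fin.ext this

theorem IsIntervalCycle.unique {s t : ℕ} {π ρ : Perm (Fin N)} (h : IsIntervalCycle s t π)
    (h' : IsIntervalCycle s t ρ) : π = ρ := by
  ext x
  rw [h x, h' x]

/-- An invariant function is determined by its values off `(s, t]`, since its value at `s`
propagates along the cycle. -/
theorem IsIntervalCycle.finrank_le {s t : ℕ} {π : Perm (Fin N)} (h : IsIntervalCycle s t π)
    (hst : s ≤ t) (ht : t < N) : finrank ℚ (invariants π) + t ≤ N + s := by
  have h1 := finrank_invariants_le (π := π)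
    (Finset.Ioc (⟨s, by omega⟩ : Fin N) ⟨t, ht⟩)ᶜ (by
      intro f hf h0
      have key : ∀ k, ∀ hk : s + k < N, s + k ≤ t → f ⟨s + k, hk⟩ = 0 := by
        intro k
        induction k with
        | zero =>
          intro hk _
          exact h0 _ (by simp)
        | succ k ih =>
          intro hk hkt
          have h2 := hf ⟨s + k, by omega⟩
          rw [ih (by omega) (by omega)] at h2
          rw [← h2]
          congr 1
          ext
          rw [h, if_neg (by simp; omega), if_pos (by simp; omega)]
          simp; omega
      ext x
      by_cases hx : x ∈ (Finset.Ioc (⟨s, by omega⟩ : Fin N) ⟨t, ht⟩)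
      · rw [Finset.mem_Ioc, Fin.lt_def, Fin.le_def] at hx
        have := key (x - s) (by have := x.2; simp at hx; omega) (by simp at hx; omega)
        rw [Pi.zero_apply, ← this]
        congr 1
        ext
        simp at hx ⊢
        omega
      · exact h0 x (by simpa using hx))
  rw [Finset.card_compl, Fintype.card_fin, Fin.card_Ioc] at h1
  simp only at h1
  omega

theorem IsIntervalCycle.le_weightSum {s t : ℕ} {F : List (Perm (Fin N))}
    (h : IsIntervalCycle s t F.prod) (hst : s ≤ t) (ht : t < N) : t ≤ weightSum F + s := by
  have h1 := h.finrank_le hst ht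
  have h2 := card_le_weightSum_add_finrank F
  rw [Fintype.card_fin] at h2
  omega

theorem IsIntervalFactorization.isReduced {s t : ℕ} {F : List (Perm (Fin N))}
    (h : IsIntervalFactorization s t F) : IsReduced F := by
  have h1 := h.prod.finrank_le h.le h.lt
  have h2 := h.weight
  unfold IsReduced
  rw [Fintype.card_fin]
  omega

theorem IsIntervalFactorization.within {s t : ℕ} {F : List (Perm (Fin N))}
    (h : IsIntervalFactorization s t F) {σ : Perm (Fin N)} (hσ : σ ∈ F) : Within s t σ := by
  intro x hx
  have hfix := h.prod.within h.le x hx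
  -- A point fixed by the product is a preserved singleton, hence fixed by every factor.
  refine (h.isReduced.mem_iff (· = x) (fun y => ?_) hσ x).2 rfl
  rw [← F.prod.injective.eq_iff (a := y), hfix]

/-- A cycle that preserves a set moves only points inside it or only points outside it. -/
theorem IsCycle.forall_or_forall {α : Type*} [Finite α] {σ : Perm α} (hσ : σ.IsCycle) (p : α → Prop)
    (hp : ∀ x, p (σ x) ↔ p x) : (∀ x, σ x ≠ x → p x) ∨ (∀ x, σ x ≠ x → ¬ p x) := by
  by_contra hc
  push Not at hc
  obtain ⟨⟨x, hx, hpx⟩, ⟨y, hy, hpy⟩⟩ := hc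
  have hpow : ∀ i : ℕ, p ((σ ^ i) x) ↔ p x := by
    intro i
    induction i with
    | zero => simp
    | succ i ih => rw [pow_succ', Perm.mul_apply, hp, ih]
  by_cases hpw : p x
  · exact hpx hpw
  · obtain ⟨i, hi⟩ := Perm.IsCycle.exists_pow_eq hσ hx hy
    rw [← hi, hpow] at hpy
    exact hpw hpy

/-! ### The order of factors that share a point -/

/-- If two factors move the same point, the one applied first moves it less far along the
interval cycle. -/
theorem IsIntervalFactorization.apply_mem_arc {s t : ℕ} {X Y Z : List (Perm (Fin N))}
    {σ τ : Perm (Fin N)} (h : IsIntervalFactorization s t (X ++ σ :: (Y ++ τ :: Z)))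
    {a : Fin N} (hσ : σ a ≠ a) (hτ : τ a ≠ a) :
    (a < σ a ∧ a < τ a ∧ τ a < σ a) ∨ (σ a < a ∧ (a < τ a ∨ τ a < σ a)) := by
  set c := (X ++ σ :: (Y ++ τ :: Z)).prod with hc
  -- Conjugating `X` by `σ⁻¹` brings `σ` to the front without changing the product, the weight or
  -- the factor `τ`.
  set L := (X.map fun x => σ⁻¹ * x * σ⁻¹⁻¹) ++ (Y ++ τ :: Z) with hL
  have hprod : (σ :: L).prod = c := by
    rw [hc, hL, List.prod_cons, List.prod_append, prod_map_conj]
    simp [mul_assoc]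
  have hred : IsReduced (σ :: L) := by
    have := h.isReduced
    unfold IsReduced at this ⊢
    rw [hprod]
    rw [← hc] at this
    rw [hL, weightSum_cons, weightSum_append, weightSum_map_conj]
    simp only [weightSum_append, weightSum_cons] at this ⊢
    omega
  have hred2 : IsReduced ((swap a (σ a) * σ) :: L) :=
    IsReduced.swap_mul (X := []) hred a (σ a) (weight_swap_mul_lt hσ)
  have hprod2 : ((swap a (σ a) * σ) :: L).prod = swap a (σ a) * c := by
    rw [← hprod]; simp [mul_assoc]
  have hin : ∀ x, σ x ≠ x → s ≤ (x : ℕ) ∧ (x : ℕ) ≤ t := by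
    intro x hx
    by_contra hcon
    exact hx (h.within (by simp) x (by omega))
  have ha := hin a hσ
  have hb := hin (σ a) (fun hx => hσ (σ.injective hx))
  have hne : (σ a : ℕ) ≠ a := fun hx => hσ (Fin.ext hx)
  have hτne : (τ a : ℕ) ≠ a := fun hx => hτ (Fin.ext hx)
  -- The predicate is the cyclic arc from `a` up to, but excluding, `σ a`, together with the fixed
  -- points outside `[s, t]` if the arc wraps around. It is preserved by `swap a (σ a) * c`, hence
  -- by `τ`, so `τ a` lies on it.
  have key := (hred2.mem_iff (fun x => (a < σ a ∧ a ≤ x ∧ x < σ a) ∨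
      (σ a < a ∧ (a ≤ x ∨ x < σ a))) (fun x => by
    rw [hprod2, Perm.mul_apply]
    have hx := h.prod x
    rw [← hc] at hx
    generalize hy : c x = y at *
    simp only [swap_apply_def, Fin.lt_def, Fin.le_def, Fin.ext_iff]
    have := x.2
    split_ifs at hx ⊢ <;> omega) (σ := τ) (by simp [hL]) a).2
  simp only [Fin.lt_def, Fin.le_def] at key ⊢
  have := key (by omega)
  omega

/-- At a common moved point `a`, the two orders would put `τ a` strictly before `σ a` and `σ a`
strictly before `τ a` on the way round from `a`. The case `σ = τ` is allowed and excludes repeated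
factors. -/
theorem IsIntervalFactorization.not_sublist {s t : ℕ} {F G : List (Perm (Fin N))}
    (hF : IsIntervalFactorization s t F) (hG : IsIntervalFactorization s t G)
    {σ τ : Perm (Fin N)} (hd : ¬ σ.Disjoint τ) (h : [σ, τ].Sublist F) :
    ¬ [τ, σ].Sublist G := by
  intro h'
  have split : ∀ {L : List (Perm (Fin N))} {ρ ρ' : Perm (Fin N)}, [ρ, ρ'].Sublist L →
      ∃ X Y Z, L = X ++ ρ :: (Y ++ ρ' :: Z) := by
    intro L ρ ρ' hs
    obtain ⟨r₁, r₂, rfl, h1, h2⟩ := List.cons_sublist_iff.1 hs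
    obtain ⟨X, Y, rfl⟩ := List.append_of_mem h1
    obtain ⟨Y', Z, rfl⟩ := List.append_of_mem (List.singleton_sublist.1 h2)
    exact ⟨X, Y ++ Y', Z, by simp⟩
  obtain ⟨X, Y, Z, rfl⟩ := split h
  obtain ⟨X', Y', Z', rfl⟩ := split h'
  unfold Perm.Disjoint at hd
  push Not at hd
  obtain ⟨a, h1, h2⟩ := hd
  have h3 := hF.apply_mem_arc h1 h2
  have h4 := hG.apply_mem_arc h2 h1
  simp only [Fin.lt_def] at h3 h4
  omega

/-! ### Equivalence classes as multisets of factors -/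

theorem Equivalent.cons {F G : List (Perm (Fin N))} (σ : Perm (Fin N)) (h : Equivalent F G) :
    Equivalent (σ :: F) (σ :: G) := by
  induction h with
  | refl => exact Relation.ReflTransGen.refl
  | tail _ hbc ih =>
    refine Relation.ReflTransGen.tail ih ?_
    obtain ⟨L, R, ρ, τ, h⟩ := hbc
    exact Exchange.mk (σ :: L) R ρ τ h

theorem equivalent_cons_append {σ : Perm (Fin N)} {L R : List (Perm (Fin N))}
    (h : ∀ τ ∈ L, σ.Disjoint τ) : Equivalent (σ :: (L ++ R)) (L ++ σ :: R) := by
  induction L with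
  | nil => exact Relation.ReflTransGen.refl
  | cons τ L ih =>
    exact Relation.ReflTransGen.head (Exchange.mk [] (L ++ R) σ τ (h τ (by simp)))
      ((ih fun ρ hρ => h ρ (by simp [hρ])).cons τ)

theorem Equivalent.perm {F G : List (Perm (Fin N))} (h : Equivalent F G) : F.Perm G := by
  induction h with
  | refl => exact List.Perm.refl _
  | tail _ hbc ih =>
    obtain ⟨L, R, σ, τ, -⟩ := hbc
    exact ih.trans ((List.Perm.swap τ σ R).append_left L)

/-- Two arrangements of the same factors are equivalent if no two factors that move a common
point occur in opposite orders. -/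
theorem equivalent_of_perm {F G : List (Perm (Fin N))} (hp : F.Perm G) (hn : F.Nodup)
    (h : ∀ σ τ : Perm (Fin N), ¬ σ.Disjoint τ → [σ, τ].Sublist F → ¬ [τ, σ].Sublist G) :
    Equivalent F G := by
  induction F generalizing G with
  | nil => rw [List.nil_perm.1 hp]; exact Relation.ReflTransGen.refl
  | cons σ F ih =>
    have hnG : G.Nodup := hp.nodup_iff.1 hn
    obtain ⟨L, R, rfl⟩ := List.append_of_mem (hp.subset (List.mem_cons_self))
    have hp' : F.Perm (L ++ R) := (List.perm_cons σ).1 (hp.trans List.perm_middle)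
    -- The factors in `L` come before `σ` in `G` but after it in `F`; by hypothesis they are
    -- disjoint from `σ`, which can therefore be moved to the front.
    have hd : ∀ τ ∈ L, σ.Disjoint τ := by
      intro τ hτ
      by_contra hc
      refine h σ τ hc ?_ ?_
      · exact List.Sublist.cons_cons σ
          (List.singleton_sublist.2 (hp'.symm.subset (by simp [hτ])))
      · exact (List.singleton_sublist.2 hτ).append
          (List.singleton_sublist.2 (List.mem_cons_self (l := R)))
    have ih' := ih hp' (List.nodup_cons.1 hn).2 (fun ρ τ hc h1 h2 =>
      h ρ τ hc (h1.trans (List.sublist_cons_self σ F)) (h2.trans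
        ((List.Sublist.refl L).append (List.sublist_cons_self σ R))))
    exact Relation.ReflTransGen.trans (ih'.cons σ) (equivalent_cons_append hd)

theorem not_disjoint_self {σ : Perm (Fin N)} (h : σ ≠ 1) : ¬ σ.Disjoint σ := fun hd =>
  h (Perm.disjoint_refl_iff.1 hd)

theorem IsIntervalFactorization.nodup {s t : ℕ} {F : List (Perm (Fin N))}
    (h : IsIntervalFactorization s t F) (h1 : ∀ σ ∈ F, σ ≠ 1) : F.Nodup := by
  rw [List.nodup_iff_sublist]
  intro σ hs
  exact h.not_sublist h (not_disjoint_self (h1 σ (hs.subset (by simp)))) hs hs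

theorem IsIntervalFactorization.equivalent {s t : ℕ} {F G : List (Perm (Fin N))}
    (hF : IsIntervalFactorization s t F) (hG : IsIntervalFactorization s t G)
    (h1 : ∀ σ ∈ F, σ ≠ 1) (hp : F.Perm G) : Equivalent F G :=
  equivalent_of_perm hp (hF.nodup h1) fun _ _ hd h => hF.not_sublist hG hd h

/-! ### Polygons at a root -/

/-- `σ` is a cycle on `j + 1` symbols, one of which is `a`; the identity if `j = 0`. -/
def IsRoot (j : ℕ) (a : Fin N) (σ : Perm (Fin N)) : Prop :=
  ∃ l : List (Fin N), (a :: l).Nodup ∧ l.length = j ∧ σ = (a :: l).formPerm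

theorem support_formPerm_card {l : List (Fin N)} (h : l.Nodup) (h2 : 2 ≤ l.length) :
    l.formPerm.support.card = l.length := by
  rw [List.support_formPerm_of_nodup l h (by rintro x rfl; simp at h2),
    List.toFinset_card_of_nodup h]

theorem IsRoot.weight {j : ℕ} {a : Fin N} {σ : Perm (Fin N)} (h : IsRoot j a σ) :
    weight σ = j := by
  obtain ⟨l, hn, rfl, rfl⟩ := h
  cases l with
  | nil => simp
  | cons b l =>
    unfold CycleFactorization.weight
    rw [support_formPerm_card hn (by simp)]
    simp

theorem isRoot_zero {a : Fin N} {σ : Perm (Fin N)} : IsRoot 0 a σ ↔ σ = 1 := by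
  constructor
  · rintro ⟨l, -, hl, rfl⟩
    rw [List.length_eq_zero_iff.1 hl, List.formPerm_singleton]
  · rintro rfl
    exact ⟨[], by simp, rfl, by simp⟩

theorem IsRoot.isKCycle {j : ℕ} {a : Fin N} {σ : Perm (Fin N)} (h : IsRoot (j + 1) a σ) :
    IsKCycle (j + 2) σ := by
  obtain ⟨l, hn, hl, rfl⟩ := h
  refine ⟨List.isCycle_formPerm hn (by simp; omega), ?_⟩
  rw [support_formPerm_card hn (by simp; omega), List.length_cons, hl]

theorem IsRoot.apply_ne {j : ℕ} {a : Fin N} {σ : Perm (Fin N)} (h : IsRoot (j + 1) a σ) :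
    σ a ≠ a := by
  obtain ⟨l, hn, hl, rfl⟩ := h
  rw [Ne, List.formPerm_apply_mem_eq_self_iff _ hn a (by simp), List.length_cons]
  omega

theorem isRoot_of_isCycle {a : Fin N} {σ : Perm (Fin N)} (h : σ.IsCycle) (ha : σ a ≠ a) :
    ∃ j, IsRoot (j + 1) a σ := by
  have h1 : (Perm.toList σ a).formPerm = σ := by
    rw [Perm.formPerm_toList, Perm.IsCycle.cycleOf_eq h ha]
  have h2 : 2 ≤ (Perm.toList σ a).length :=
    Perm.two_le_length_toList_iff_mem_support.2 (Perm.mem_support.2 ha)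
  have h3 := Perm.nodup_toList σ a
  have h4 : (Perm.toList σ a)[0]? = some a := by
    rw [List.getElem?_eq_getElem (by omega), Perm.toList_getElem_zero]
    exact Perm.mem_support.2 ha
  generalize Perm.toList σ a = l at *
  cases l with
  | nil => simp at h2
  | cons b l =>
    simp only [List.getElem?_cons_zero, Option.some_inj] at h4
    subst h4
    exact ⟨l.length - 1, l, h3, by simp at h2; omega, h1.symm⟩

/-- The new vertex `b` becomes the last one, visited just before the return to `a`. Hence
`IsRoot.shrink`, the inverse operation, finds it as `σ⁻¹ a`. -/
theorem IsRoot.extend {j : ℕ} {a b : Fin N} {σ : Perm (Fin N)} (h : IsRoot j a σ)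
    (hab : b ≠ a) (hb : σ b = b) : IsRoot (j + 1) a (swap a b * σ) := by
  obtain ⟨l, hn, hl, rfl⟩ := h
  have hbl : b ∉ a :: l := by
    intro hmem
    rw [List.formPerm_apply_mem_eq_self_iff _ hn b hmem] at hb
    have : l = [] := by
      rw [← List.length_eq_zero_iff]; rw [List.length_cons] at hb; omega
    simp [this, hab] at hmem
  have hn' : (b :: a :: l).Nodup := List.nodup_cons.2 ⟨hbl, hn⟩
  have hr : (b :: a :: l).rotate 1 = a :: (l ++ [b]) := by simp
  refine ⟨l ++ [b], ?_, by simp [hl], ?_⟩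
  · rw [← hr]; exact List.nodup_rotate.2 hn'
  · rw [← hr, List.formPerm_rotate _ hn', List.formPerm_cons_cons, swap_comm]

theorem IsRoot.shrink {j : ℕ} {a : Fin N} {σ : Perm (Fin N)} (h : IsRoot (j + 1) a σ) :
    IsRoot j a (swap a (σ⁻¹ a) * σ) := by
  obtain ⟨l, hn, hl, rfl⟩ := h
  obtain ⟨l, b, rfl⟩ : ∃ l' b, l = l' ++ [b] := by
    rcases List.eq_nil_or_concat l with rfl | ⟨l', b, rfl⟩
    · simp at hl
    · exact ⟨l', b, by simp⟩
  have hr : (b :: a :: l).rotate 1 = a :: (l ++ [b]) := by simp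
  have hn' : (b :: a :: l).Nodup := by rw [← List.nodup_rotate (n := 1), hr]; exact hn
  have hf : (a :: (l ++ [b])).formPerm = swap b a * (a :: l).formPerm := by
    rw [← hr, List.formPerm_rotate _ hn', List.formPerm_cons_cons]
  have hfix : (a :: l).formPerm b = b :=
    List.formPerm_apply_of_notMem (List.nodup_cons.1 hn').1
  have hb : (a :: (l ++ [b])).formPerm⁻¹ a = b := by
    rw [Perm.inv_eq_iff_eq, hf, Perm.mul_apply, hfix, swap_apply_left]
  refine ⟨l, (List.nodup_cons.1 hn').2, by simpa using hl, ?_⟩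
  rw [hb, hf, swap_comm a b, swap_mul_self_mul]

/-! ### Cactuses and the factorizations they encode -/

/-- Plane trees encoding cactuses: a cactus with a distinguished root corner carries an open
polygon with `j + 1` vertices at its root. -/
inductive Cactus : ℕ → Type
  | nil : Cactus 0
  | close {j : ℕ} (T : Cactus (j + 1)) : Cactus 0
  | ext {j : ℕ} (T : Cactus j) (G H : Cactus 0) : Cactus (j + 1)

/-- The Łukasiewicz word of a cactus: `0` for a leaf, `j + 1` for a closed `(j + 2)`-gon. -/
def Cactus.word : {j : ℕ} → Cactus j → List ℕ
  | _, .nil => [0]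
  | _, .close (j := j) T => (j + 1) :: T.word
  | _, .ext T G H => T.word ++ (G.word ++ H.word)

/-- The number of vertices other than the root. -/
def Cactus.size {j : ℕ} (T : Cactus j) : ℕ := j + T.word.sum

@[simp] theorem Cactus.size_nil : Cactus.nil.size = 0 := by simp [size, word]

@[simp] theorem Cactus.size_close {j : ℕ} (T : Cactus (j + 1)) :
    (Cactus.close T).size = T.size := by simp [size, word]

@[simp] theorem Cactus.size_ext {j : ℕ} (T : Cactus j) (G H : Cactus 0) :
    (Cactus.ext T G H).size = T.size + 1 + G.size + H.size := by
  simp [size, word]; omega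

/-- A natural number as a symbol. -/
def pt [NeZero N] (a : ℕ) : Fin N := Fin.ofNat N a

theorem val_pt [NeZero N] {a : ℕ} (h : a < N) : ((pt a : Fin N) : ℕ) = a := by
  simp [pt, Nat.mod_eq_of_lt h]

theorem pt_val [NeZero N] (a : Fin N) : pt (a : ℕ) = a := by
  simp [pt]

/-- The factorization encoded by a cactus with root `s`, split at the open polygon: the factors
to its left, the polygon, and the factors to its right. -/
def Cactus.eval [NeZero N] : {j : ℕ} → Cactus j → ℕ →
    List (Perm (Fin N)) × Perm (Fin N) × List (Perm (Fin N))
  | _, .nil, _ => ([], 1, [])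
  | _, .close T, s => ([], 1, (T.eval s).1 ++ (T.eval s).2.1 :: (T.eval s).2.2)
  | _, .ext T G H, s =>
    ((T.eval s).1 ++ (G.eval (s + T.size + 1)).2.2,
      swap (pt s) (pt (s + T.size + 1 + G.size)) * (T.eval s).2.1,
      (H.eval (s + T.size + 1 + G.size)).2.2 ++ (T.eval s).2.2)

/-- The factorization encoded by a cactus without open polygon. -/
def Cactus.factors (N : ℕ) [NeZero N] (T : Cactus 0) (s : ℕ) : List (Perm (Fin N)) :=
  (T.eval s).2.2

theorem Cactus.eval_zero [NeZero N] (T : Cactus 0) (s : ℕ) :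
    T.eval s = ([], 1, T.factors N s) := by
  cases T <;> simp [eval, factors]

/-- `A ++ σ :: B` is a minimal factorization of `(s s+1 … t)` into cycles, in which `σ` is the
open polygon, with `j + 1` vertices, to the left of all other factors that move `s`. -/
structure IsMarked [NeZero N] (j s t : ℕ) (A : List (Perm (Fin N))) (σ : Perm (Fin N))
    (B : List (Perm (Fin N))) : Prop where
  fact : IsIntervalFactorization s t (A ++ σ :: B)
  isCycle : ∀ τ ∈ A ++ B, τ.IsCycle
  fix : ∀ τ ∈ A, τ (pt s) = pt s
  root : IsRoot j (pt s) σ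

theorem list_prod_apply_eq {α : Type*} {F : List (Perm α)} {a : α} (h : ∀ τ ∈ F, τ a = a) :
    F.prod a = a := by
  induction F with
  | nil => rfl
  | cons σ F ih =>
    rw [List.prod_cons, Perm.mul_apply, ih fun τ hτ => h τ (by simp [hτ]), h σ (by simp)]

theorem isIntervalFactorization_one_cons {s t : ℕ} {F : List (Perm (Fin N))} :
    IsIntervalFactorization s t (1 :: F) ↔ IsIntervalFactorization s t F := by
  constructor
  · rintro ⟨h1, h2, h3, h4⟩
    exact ⟨h1, h2, by simpa using h3, by simpa using h4⟩
  · rintro ⟨h1, h2, h3, h4⟩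
    exact ⟨h1, h2, by simpa using h3, by simpa using h4⟩

theorem isMarked_zero [NeZero N] {s t : ℕ} {F : List (Perm (Fin N))} :
    IsMarked 0 s t [] 1 F ↔ IsIntervalFactorization s t F ∧ ∀ τ ∈ F, τ.IsCycle := by
  constructor
  · rintro ⟨h1, h2, -, -⟩
    exact ⟨isIntervalFactorization_one_cons.1 h1, by simpa using h2⟩
  · rintro ⟨h1, h2⟩
    exact ⟨isIntervalFactorization_one_cons.2 h1, by simpa using h2, by simp, isRoot_zero.2 rfl⟩

theorem IsMarked.isCycle_all [NeZero N] {j s t : ℕ} {A B : List (Perm (Fin N))}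
    {σ : Perm (Fin N)} (h : IsMarked (j + 1) s t A σ B) : ∀ τ ∈ A ++ σ :: B, τ.IsCycle := by
  intro τ hτ
  have h1 := h.isCycle τ
  simp only [List.mem_append, List.mem_cons] at hτ h1
  rcases hτ with h' | rfl | h'
  · exact h1 (Or.inl h')
  · exact h.root.isKCycle.1
  · exact h1 (Or.inr h')

theorem IsMarked.lt [NeZero N] {j s t : ℕ} {A B : List (Perm (Fin N))}
    {σ : Perm (Fin N)} (h : IsMarked j s t A σ B) : s < N :=
  h.fact.le.trans_lt h.fact.lt

theorem IsMarked.within [NeZero N] {j s t : ℕ} {A B : List (Perm (Fin N))}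
    {σ : Perm (Fin N)} (h : IsMarked j s t A σ B) {τ : Perm (Fin N)} (hτ : τ ∈ A ++ B) :
    Within s t τ :=
  h.fact.within (by simp only [List.mem_append, List.mem_cons] at hτ ⊢; tauto)

/-- The point `a` becomes the last vertex of the polygon; `G` and `H` are what hangs to its left and
right. Since `A` fixes `s` and the intervals `[s, p]` and `[a, t]` are disjoint, the product
rearranges to `G · (s a) · H · (A σ B)`, which is evaluated point by point. -/
theorem IsMarked.extend [NeZero N] {j s p a t : ℕ} {A B G H : List (Perm (Fin N))}
    {σ : Perm (Fin N)} (h : IsMarked j s p A σ B)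
    (hG : IsIntervalFactorization (p + 1) a G) (hGc : ∀ τ ∈ G, τ.IsCycle)
    (hH : IsIntervalFactorization a t H) (hHc : ∀ τ ∈ H, τ.IsCycle) :
    IsMarked (j + 1) s t (A ++ G) (swap (pt s) (pt a) * σ) (H ++ B) := by
  have hs := h.lt
  have hsp := h.fact.le
  have hpa := hG.le
  have hat := hH.le
  have ht := hH.lt
  have hvs := val_pt hs
  have hva := val_pt (N := N) (a := a) (by omega)
  have hAw : Within s p A.prod := Within.list_prod fun τ hτ => h.within (by simp [hτ])
  have hBw : Within s p B.prod := Within.list_prod fun τ hτ => h.within (by simp [hτ])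
  have hσw : Within s p σ := h.fact.within (by simp)
  have hGw : Within (p + 1) a G.prod := hG.prod.within hG.le
  have hHw : Within a t H.prod := hH.prod.within hH.le
  have hroot : IsRoot (j + 1) (pt s) (swap (pt s) (pt a) * σ) :=
    h.root.extend (fun hc => by rw [Fin.ext_iff] at hc; omega) (hσw _ (by omega))
  refine ⟨⟨by omega, ht, ?_, ?_⟩, ?_, ?_, hroot⟩
  · have hAG : A.prod * G.prod = G.prod * A.prod :=
      (hAw.disjoint hGw (by omega)).commute
    have hAH : A.prod * H.prod = H.prod * A.prod :=
      (hAw.disjoint hHw (by omega)).commute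
    have hσH : σ * H.prod = H.prod * σ := (hσw.disjoint hHw (by omega)).commute
    have hAs : A.prod * swap (pt s) (pt a) = swap (pt s) (pt a) * A.prod := by
      rw [mul_swap_eq_swap_mul, list_prod_apply_eq h.fix, hAw _ (by omega)]
    have hprod : (A ++ G ++ swap (pt s) (pt a) * σ :: (H ++ B)).prod =
        G.prod * swap (pt s) (pt a) * H.prod * (A ++ σ :: B).prod := by
      simp only [List.prod_append, List.prod_cons]
      calc A.prod * G.prod * (swap (pt s) (pt a) * σ * (H.prod * B.prod))
          = (A.prod * G.prod) * swap (pt s) (pt a) * (σ * H.prod) * B.prod := by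
            simp only [mul_assoc]
        _ = G.prod * (A.prod * swap (pt s) (pt a)) * H.prod * σ * B.prod := by
            rw [hAG, hσH]; simp only [mul_assoc]
        _ = G.prod * swap (pt s) (pt a) * (A.prod * H.prod) * σ * B.prod := by
            rw [hAs]; simp only [mul_assoc]
        _ = _ := by rw [hAH]; simp only [mul_assoc]
    intro x
    rw [hprod]
    simp only [Perm.mul_apply]
    have h1 := h.fact.prod x
    generalize (A ++ σ :: B).prod x = y1 at *
    have h2 := hH.prod y1
    generalize H.prod y1 = y2 at *
    have h3 : ((swap (pt s) (pt a) y2 : Fin N) : ℕ) =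
        if (y2 : ℕ) = s then a else if (y2 : ℕ) = a then s else y2 := by
      simp only [swap_apply_def, Fin.ext_iff, hvs, hva]
      split_ifs <;> first | assumption | omega
    generalize swap (pt s) (pt a) y2 = y3 at *
    have h4 := hG.prod y3
    rw [h4]
    split_ifs at * <;> omega
  · have h1 := h.fact.weight
    have h2 := hG.weight
    have h3 := hH.weight
    have h4 := hroot.weight
    have h5 := h.root.weight
    simp only [weightSum_append, weightSum_cons] at *
    omega
  · intro τ hτ
    have h1 := h.isCycle τ
    simp only [List.mem_append] at hτ h1
    rcases hτ with (h' | h') | (h' | h')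
    · exact h1 (Or.inl h')
    · exact hGc τ h'
    · exact hHc τ h'
    · exact h1 (Or.inr h')
  · intro τ hτ
    rcases List.mem_append.1 hτ with h' | h'
    · exact h.fix τ h'
    · exact hG.within h' _ (by omega)

theorem Cactus.isMarked [NeZero N] {j : ℕ} (T : Cactus j) (s : ℕ) (h : s + T.size < N) :
    IsMarked (N := N) j s (s + T.size) (T.eval s).1 (T.eval s).2.1 (T.eval s).2.2 := by
  induction T generalizing s with
  | nil =>
    refine isMarked_zero.2 ⟨⟨by simp, h, ?_, by simp [eval]⟩, by simp [eval]⟩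
    intro x
    simp only [eval, size_nil, List.prod_nil, Perm.one_apply]
    split_ifs <;> omega
  | close T ih =>
    rw [size_close] at h ⊢
    exact isMarked_zero.2 ⟨(ih s h).fact, (ih s h).isCycle_all⟩
  | ext T G H ihT ihG ihH =>
    rw [size_ext] at h
    have hG := ihG (s + T.size + 1) (by omega)
    have hH := ihH (s + T.size + 1 + G.size) (by omega)
    rw [eval_zero] at hG hH
    rw [isMarked_zero] at hG hH
    have := (ihT s (by omega)).extend hG.1 hG.2 hH.1 hH.2
    rw [show s + (Cactus.ext T G H).size = s + T.size + 1 + G.size + H.size by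
      rw [size_ext]; omega]
    exact this

theorem Cactus.isIntervalFactorization [NeZero N] (T : Cactus 0) (s : ℕ) (h : s + T.size < N) :
    IsIntervalFactorization s (s + T.size) (T.factors N s) ∧ ∀ τ ∈ T.factors N s, τ.IsCycle := by
  have := T.isMarked s h
  rw [eval_zero] at this
  exact isMarked_zero.1 this

/-! ### Recovering a cactus from its multiset of factors -/

theorem Within.le_iff {s t p : ℕ} {σ : Perm (Fin N)} (h : Within s t σ) (hp : t ≤ p ∨ p < s)
    (x : Fin N) : (σ x : ℕ) ≤ p ↔ (x : ℕ) ≤ p := by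
  by_cases hx : s ≤ (x : ℕ) ∧ (x : ℕ) ≤ t
  · have := (h.mem_iff x).2 hx
    omega
  · rw [h x (by omega)]

theorem list_prod_mem_iff {α : Type*} {F : List (Perm α)} {p : α → Prop}
    (h : ∀ τ ∈ F, ∀ x, p (τ x) ↔ p x) (x : α) : p (F.prod x) ↔ p x := by
  induction F with
  | nil => rfl
  | cons σ F ih =>
    rw [List.prod_cons, Perm.mul_apply, h σ (by simp), ih fun τ hτ => h τ (by simp [hτ])]

theorem Within.exists_ne {s t : ℕ} {σ : Perm (Fin N)} (h : Within s t σ) (hσ : σ ≠ 1) :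
    ∃ x : Fin N, s ≤ (x : ℕ) ∧ (x : ℕ) < t ∧ σ x ≠ x := by
  obtain ⟨x, hx⟩ : ∃ x, σ x ≠ x := by
    by_contra hc
    push Not at hc
    exact hσ (Perm.ext hc)
  have hx' : σ (σ x) ≠ σ x := fun hc => hx (σ.injective hc)
  have h1 : s ≤ (x : ℕ) ∧ (x : ℕ) ≤ t := by
    by_contra hc
    exact hx (h x (by omega))
  have h2 := (h.mem_iff x).2 h1
  have h3 : (σ x : ℕ) ≠ x := fun hc => hx (Fin.ext hc)
  by_cases h4 : (x : ℕ) < t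
  · exact ⟨x, h1.1, h4, hx⟩
  · exact ⟨σ x, h2.1, by omega, hx'⟩

/-- By the arc lemma, the leftmost factor that moves `s` is the one that moves it farthest, a
property independent of the order of the factors. -/
theorem IsMarked.root_unique [NeZero N] {j j' s t : ℕ} {A B A' B' : List (Perm (Fin N))}
    {σ σ' : Perm (Fin N)} (h : IsMarked (j + 1) s t A σ B) (h' : IsMarked (j' + 1) s t A' σ' B')
    (hp : (A ++ σ :: B).Perm (A' ++ σ' :: B')) : σ = σ' ∧ j = j' := by
  have aux : ∀ {j j' : ℕ} {A B A' B' : List (Perm (Fin N))} {σ σ' : Perm (Fin N)},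
      IsMarked (j + 1) s t A σ B → IsMarked (j' + 1) s t A' σ' B' →
      (A ++ σ :: B).Perm (A' ++ σ' :: B') → σ ≠ σ' → σ' (pt s) < σ (pt s) := by
    intro j j' A B A' B' σ σ' h h' hp hne
    have hm : σ' ∈ A ++ σ :: B := hp.symm.subset (by simp)
    have hB : σ' ∈ B := by
      rcases List.mem_append.1 hm with hm | hm
      · exact absurd (h.fix σ' hm) h'.root.apply_ne
      · exact (List.mem_cons.1 hm).resolve_left (Ne.symm hne)
    obtain ⟨Y, Z, rfl⟩ := List.append_of_mem hB
    have h1 := h.fact.apply_mem_arc h.root.apply_ne h'.root.apply_ne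
    have h2 := ((h.fact.within (σ := σ) (by simp)).mem_iff (pt s)).2
      (by rw [val_pt h.lt]; exact ⟨le_rfl, h.fact.le⟩)
    have h3 := val_pt h.lt
    simp only [Fin.lt_def] at h1 ⊢
    omega
  have hσ : σ = σ' := by
    by_contra hne
    have h1 := aux h h' hp hne
    have h2 := aux h' h hp.symm (Ne.symm hne)
    exact absurd h1 (not_lt.2 h2.le)
  subst hσ
  have h1 := h.root.weight
  have h2 := h'.root.weight
  exact ⟨rfl, by omega⟩

-- Inverts `IsMarked.extend` on multisets: `a` is the preimage of `s` under the polygon, and the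
-- three groups of factors are told apart by the intervals that contain their supports.
open Classical in
theorem IsMarked.extend_perm [NeZero N] {j s p a t p' a' t' : ℕ}
    {A B G H A' B' G' H' : List (Perm (Fin N))} {σ σ' : Perm (Fin N)}
    (h : IsMarked j s p A σ B)
    (hG : IsIntervalFactorization (p + 1) a G) (hGc : ∀ τ ∈ G, τ.IsCycle)
    (hH : IsIntervalFactorization a t H) (hHc : ∀ τ ∈ H, τ.IsCycle)
    (h' : IsMarked j s p' A' σ' B')
    (hG' : IsIntervalFactorization (p' + 1) a' G') (hGc' : ∀ τ ∈ G', τ.IsCycle)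
    (hH' : IsIntervalFactorization a' t' H') (hHc' : ∀ τ ∈ H', τ.IsCycle)
    (hσ : swap (pt s) (pt a) * σ = swap (pt s) (pt a') * σ')
    (hp : ((A ++ G) ++ (H ++ B)).Perm ((A' ++ G') ++ (H' ++ B'))) :
    p = p' ∧ a = a' ∧ σ = σ' ∧ (A ++ B).Perm (A' ++ B') ∧ G.Perm G' ∧ H.Perm H' := by
  have root_inv : ∀ {p a : ℕ} {A B G : List (Perm (Fin N))} {σ : Perm (Fin N)},
      IsMarked j s p A σ B → IsIntervalFactorization (p + 1) a G →
      (swap (pt s) (pt a) * σ : Perm (Fin N)) (pt a) = pt s := by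
    intro p a A B G σ h hG
    have h1 : σ (pt a) = pt a := h.fact.within (by simp) _ (by
      rw [val_pt hG.lt]; have := hG.le; omega)
    rw [Perm.mul_apply, h1, swap_apply_right]
  have ha : a = a' := by
    have h1 := root_inv h hG
    have h2 := root_inv h' hG'
    rw [hσ] at h1
    have h3 := congrArg Fin.val (Equiv.injective _ (h1.trans h2.symm))
    rwa [val_pt hG.lt, val_pt hG'.lt] at h3
  subst ha
  have hσ' : σ = σ' := mul_left_cancel hσ
  subst hσ'
  -- Only the members of `H` fix everything below `a`: the others are nontrivial and live on
  -- intervals ending at or before `a`, so they move a point below `a`.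
  have filterH : ∀ {p t : ℕ} {A B G H : List (Perm (Fin N))},
      IsMarked j s p A σ B → IsIntervalFactorization (p + 1) a G → (∀ τ ∈ G, τ.IsCycle) →
      IsIntervalFactorization a t H →
      ((A ++ G) ++ (H ++ B)).filter
        (fun τ => decide (∀ x : Fin N, (x : ℕ) < a → τ x = x)) = H := by
    intro p t A B G H h hG hGc hH
    have hle := hG.le
    have hAB : ∀ τ ∈ A ++ B, ¬ ∀ x : Fin N, (x : ℕ) < a → τ x = x := by
      intro τ hτ hc
      obtain ⟨x, -, h2, h3⟩ := (h.within hτ).exists_ne (h.isCycle τ hτ).ne_one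
      exact h3 (hc x (by omega))
    have e1 : A.filter (fun τ => decide (∀ x : Fin N, (x : ℕ) < a → τ x = x)) = [] :=
      List.filter_eq_nil_iff.2 fun τ hτ => by simpa using hAB τ (by simp [hτ])
    have e2 : B.filter (fun τ => decide (∀ x : Fin N, (x : ℕ) < a → τ x = x)) = [] :=
      List.filter_eq_nil_iff.2 fun τ hτ => by simpa using hAB τ (by simp [hτ])
    have e3 : G.filter (fun τ => decide (∀ x : Fin N, (x : ℕ) < a → τ x = x)) = [] :=
      List.filter_eq_nil_iff.2 fun τ hτ => by
        obtain ⟨x, -, h2, h3⟩ := (hG.within hτ).exists_ne (hGc τ hτ).ne_one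
        simp only [decide_eq_true_eq]
        exact fun hc => h3 (hc x h2)
    have e4 : H.filter (fun τ => decide (∀ x : Fin N, (x : ℕ) < a → τ x = x)) = H :=
      List.filter_eq_self.2 fun τ hτ => by
        simp only [decide_eq_true_eq]
        exact fun x hx => hH.within hτ x (by omega)
    simp only [List.filter_append, e1, e2, e3, e4, List.nil_append, List.append_nil]
  have hHp : H.Perm H' := by
    have := hp.filter (fun τ => decide (∀ x : Fin N, (x : ℕ) < a → τ x = x))
    rwa [filterH h hG hGc hH, filterH h' hG' hGc' hH'] at this
  -- If `p < p'`, every factor of `(s … p')` would preserve the points up to `p`, yet that cycle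
  -- sends `p` to `p + 1`.
  have not_lt : ∀ {p p' t t' : ℕ} {A B G H A' B' G' H' : List (Perm (Fin N))},
      IsMarked j s p A σ B → IsIntervalFactorization (p + 1) a G →
      IsIntervalFactorization a t H → IsMarked j s p' A' σ B' →
      ((A ++ G) ++ (H ++ B)).Perm ((A' ++ G') ++ (H' ++ B')) → ¬ p < p' := by
    intro p p' t t' A B G H A' B' G' H' h hG hH h' hp hlt
    have hle := hG.le
    have key : ∀ τ ∈ A' ++ σ :: B', ∀ x : Fin N, (τ x : ℕ) ≤ p ↔ (x : ℕ) ≤ p := by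
      intro τ hτ
      by_cases hτσ : τ = σ
      · subst hτσ
        exact (h.fact.within (by simp)).le_iff (Or.inl le_rfl)
      · have hm : τ ∈ (A ++ G) ++ (H ++ B) := hp.symm.subset (by
          simp only [List.mem_append, List.mem_cons] at hτ ⊢; tauto)
        simp only [List.mem_append] at hm
        rcases hm with (hm | hm) | (hm | hm)
        · exact (h.within (by simp [hm])).le_iff (Or.inl le_rfl)
        · exact (hG.within hm).le_iff (Or.inr (by omega))
        · exact (hH.within hm).le_iff (Or.inr (by omega))
        · exact (h.within (by simp [hm])).le_iff (Or.inl le_rfl)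
    have hpN : p < N := h.fact.lt
    have h1 := (list_prod_mem_iff (p := fun x : Fin N => (x : ℕ) ≤ p) key (pt p)).2
      (val_pt hpN).le
    have hsp := h.fact.le
    rw [h'.fact.prod, val_pt hpN, if_neg (by omega), if_pos (by omega)] at h1
    omega
  have hpp : p = p' := by
    have h1 := not_lt (t' := t) h hG hH h' hp
    have h2 := not_lt (t' := t) h' hG' hH' h hp.symm
    omega
  subst hpp
  have filterAB : ∀ {t : ℕ} {A B G H : List (Perm (Fin N))},
      IsMarked j s p A σ B → IsIntervalFactorization (p + 1) a G → (∀ τ ∈ G, τ.IsCycle) →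
      IsIntervalFactorization a t H → (∀ τ ∈ H, τ.IsCycle) →
      ((A ++ G) ++ (H ++ B)).filter
        (fun τ => decide (∀ x : Fin N, p < (x : ℕ) → τ x = x)) = A ++ B := by
    intro t A B G H h hG hGc hH hHc
    have hle := hG.le
    have hAB : ∀ τ ∈ A ++ B, ∀ x : Fin N, p < (x : ℕ) → τ x = x :=
      fun τ hτ x hx => h.within hτ x (by omega)
    have e1 : A.filter (fun τ => decide (∀ x : Fin N, p < (x : ℕ) → τ x = x)) = A :=
      List.filter_eq_self.2 fun τ hτ => by simpa using hAB τ (by simp [hτ])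
    have e2 : B.filter (fun τ => decide (∀ x : Fin N, p < (x : ℕ) → τ x = x)) = B :=
      List.filter_eq_self.2 fun τ hτ => by simpa using hAB τ (by simp [hτ])
    have e3 : G.filter (fun τ => decide (∀ x : Fin N, p < (x : ℕ) → τ x = x)) = [] :=
      List.filter_eq_nil_iff.2 fun τ hτ => by
        obtain ⟨x, h1, -, h3⟩ := (hG.within hτ).exists_ne (hGc τ hτ).ne_one
        simp only [decide_eq_true_eq]
        exact fun hc => h3 (hc x (by omega))
    have e4 : H.filter (fun τ => decide (∀ x : Fin N, p < (x : ℕ) → τ x = x)) = [] :=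
      List.filter_eq_nil_iff.2 fun τ hτ => by
        obtain ⟨x, h1, -, h3⟩ := (hH.within hτ).exists_ne (hHc τ hτ).ne_one
        simp only [decide_eq_true_eq]
        exact fun hc => h3 (hc x (by omega))
    simp only [List.filter_append, e1, e2, e3, e4, List.nil_append, List.append_nil]
  have hABp : (A ++ B).Perm (A' ++ B') := by
    have := hp.filter (fun τ => decide (∀ x : Fin N, p < (x : ℕ) → τ x = x))
    rwa [filterAB h hG hGc hH hHc, filterAB h' hG' hGc' hH' hHc'] at this
  refine ⟨rfl, rfl, rfl, hABp, ?_, hHp⟩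
  rw [← Multiset.coe_eq_coe] at hp hABp hHp ⊢
  simp only [← Multiset.coe_add] at hp hABp hHp ⊢
  -- `G` is what remains after cancelling the other groups.
  have e : ∀ a b c d : Multiset (Perm (Fin N)), a + b + (c + d) = b + ((a + d) + c) := by
    intro a b c d; abel
  rw [e, e, hABp, hHp] at hp
  exact add_right_cancel hp

/-- A cactus can be recovered from the factors of its factorization. -/
theorem Cactus.eq_of_eval_perm [NeZero N] {j : ℕ} (T T' : Cactus j) (s : ℕ)
    (h : s + T.size < N) (h' : s + T'.size < N)
    (hσ : (T.eval s).2.1 = ((T'.eval s).2.1 : Perm (Fin N)))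
    (hp : ((T.eval s).1 ++ (T.eval s).2.2 : List (Perm (Fin N))).Perm
      ((T'.eval s).1 ++ (T'.eval s).2.2)) : T = T' := by
  induction T generalizing s with
  | nil =>
    cases T' with
    | nil => rfl
    | close T' =>
      have := hp.length_eq
      simp [eval] at this
  | @close j T ih =>
    cases T' with
    | nil =>
      have := hp.length_eq
      simp [eval] at this
    | @close j' T' =>
      rw [size_close] at h h'
      have h1 := T.isMarked (N := N) s h
      have h2 := T'.isMarked (N := N) s h'
      simp only [eval, List.nil_append] at hp
      have hsz : s + T'.size = s + T.size := by
        rw [← h1.fact.weight, ← h2.fact.weight, weightSum_perm hp]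
      rw [hsz] at h2
      obtain ⟨hroot, rfl⟩ := h1.root_unique h2 hp
      refine congrArg _ (ih T' s h h' hroot ?_)
      rw [hroot] at hp
      exact (List.perm_cons _).1 (List.perm_middle.symm.trans (hp.trans List.perm_middle))
  | ext T G H ihT ihG ihH =>
    cases T' with
    | ext T' G' H' =>
      rw [size_ext] at h h'
      have h1 := T.isMarked (N := N) s (by omega)
      have h2 := G.isIntervalFactorization (N := N) (s + T.size + 1) (by omega)
      have h3 := H.isIntervalFactorization (N := N) (s + T.size + 1 + G.size) (by omega)
      have h1' := T'.isMarked (N := N) s (by omega)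
      have h2' := G'.isIntervalFactorization (N := N) (s + T'.size + 1) (by omega)
      have h3' := H'.isIntervalFactorization (N := N) (s + T'.size + 1 + G'.size) (by omega)
      obtain ⟨e1, e2, e3, e4, e5, e6⟩ :=
        h1.extend_perm h2.1 h2.2 h3.1 h3.2 h1' h2'.1 h2'.2 h3'.1 h3'.2 hσ hp
      have eT := ihT T' s (by omega) (by omega) e3 e4
      subst eT
      have eG := ihG G' (s + T.size + 1) (by omega) (by omega)
        (by rw [eval_zero, eval_zero]) (by rw [eval_zero, eval_zero]; exact e5)
      subst eG
      have eH := ihH H' (s + T.size + 1 + G.size) (by omega) (by omega)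
        (by rw [eval_zero, eval_zero]) (by rw [eval_zero, eval_zero]; exact e6)
      rw [eH]

/-! ### Cutting a marked factorization; every factorization comes from a cactus -/

theorem commute_list_prod {M : Type*} [Monoid M] {F : List M} {σ : M}
    (h : ∀ τ ∈ F, Commute σ τ) : Commute σ F.prod :=
  Commute.list_prod_right F σ h

/-- A product of elements of three mutually commuting kinds can be sorted by kind. -/
theorem exists_sorted {M : Type*} [Monoid M] (P Q R : M → Prop)
    (hQP : ∀ σ τ, Q σ → P τ → Commute σ τ) (hRP : ∀ σ τ, R σ → P τ → Commute σ τ)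
    (hRQ : ∀ σ τ, R σ → Q τ → Commute σ τ) (L : List M)
    (h : ∀ σ ∈ L, P σ ∨ Q σ ∨ R σ) :
    ∃ L₁ L₂ L₃ : List M, (L₁ ++ (L₂ ++ L₃)).Perm L ∧ L.prod = L₁.prod * L₂.prod * L₃.prod ∧
      (∀ σ ∈ L₁, P σ) ∧ (∀ σ ∈ L₂, Q σ) ∧ (∀ σ ∈ L₃, R σ) := by
  induction L with
  | nil => exact ⟨[], [], [], by simp, by simp, by simp, by simp, by simp⟩
  | cons σ L ih =>
    obtain ⟨L₁, L₂, L₃, hp, hprod, h1, h2, h3⟩ := ih fun τ hτ => h τ (by simp [hτ])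
    rcases h σ (by simp) with hσ | hσ | hσ
    · refine ⟨σ :: L₁, L₂, L₃, hp.cons σ, by simp [hprod, mul_assoc], ?_, h2, h3⟩
      simpa using ⟨hσ, h1⟩
    · have hc : Commute σ L₁.prod := commute_list_prod fun τ hτ => hQP σ τ hσ (h1 τ hτ)
      refine ⟨L₁, σ :: L₂, L₃, List.perm_middle.trans (hp.cons σ), ?_, h1, ?_, h3⟩
      · rw [List.prod_cons, List.prod_cons, hprod, ← mul_assoc, ← mul_assoc, hc.eq,
          mul_assoc L₁.prod σ]
      · simpa using ⟨hσ, h2⟩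
    · have hc : Commute σ (L₁.prod * L₂.prod) :=
        (commute_list_prod fun τ hτ => hRP σ τ hσ (h1 τ hτ)).mul_right
          (commute_list_prod fun τ hτ => hRQ σ τ hσ (h2 τ hτ))
      refine ⟨L₁, L₂, σ :: L₃, ?_, ?_, h1, h2, ?_⟩
      · rw [← List.append_assoc] at hp ⊢
        exact List.perm_middle.trans (hp.cons σ)
      · rw [List.prod_cons, List.prod_cons, hprod, ← mul_assoc, hc.eq]
        simp only [mul_assoc]
      · simpa using ⟨hσ, h3⟩

/-- A product of permutations of consecutive intervals that is a product of interval cycles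
consists of interval cycles. -/
theorem isIntervalCycle_of_mul {s p a t : ℕ} (hsp : s ≤ p) (hpa : p + 1 ≤ a) (hat : a ≤ t)
    (ht : t < N) {κ γ η : Perm (Fin N)} (hκ : Within s p κ) (hγ : Within (p + 1) a γ)
    (hη : Within a t η)
    (h : ∀ x : Fin N, ((κ * γ * η) x : ℕ) = if (x : ℕ) = p then s else
      if (x : ℕ) = t then p + 1 else
        if s ≤ (x : ℕ) ∧ (x : ℕ) < t then (x : ℕ) + 1 else x) :
    IsIntervalCycle s p κ ∧ IsIntervalCycle (p + 1) a γ ∧ IsIntervalCycle a t η := by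
  have hκc : IsIntervalCycle s p κ := by
    intro x
    by_cases hx : (x : ℕ) ≤ p
    · have h1 := h x
      rw [Perm.mul_apply, Perm.mul_apply, hη x (by omega), hγ x (by omega)] at h1
      rw [h1]
      split_ifs <;> omega
    · rw [hκ x (by omega)]
      split_ifs <;> omega
  have hγη : ∀ x : Fin N, p < (x : ℕ) → (γ (η x) : ℕ) =
      if (x : ℕ) = t then p + 1 else if (x : ℕ) < t then (x : ℕ) + 1 else x := by
    intro x hx
    have h1 : ¬ (γ (η x) : ℕ) ≤ p := by
      have h2 := hη.le_iff (p := p) (Or.inr (by omega)) x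
      have h3 := hγ.le_iff (p := p) (Or.inr (by omega)) (η x)
      omega
    have h2 := h x
    rw [Perm.mul_apply, Perm.mul_apply, hκ _ (by omega)] at h2
    rw [h2]
    split_ifs <;> omega
  -- The point `a` is the only one shared by the intervals of `η` and `γ`, so the passage from `t`
  -- to `p + 1` must go through it.
  have hηt : η ⟨t, ht⟩ = ⟨a, by omega⟩ := by
    have h1 := hγη ⟨t, ht⟩ (by simp only; omega)
    have h2 := (hη.mem_iff ⟨t, ht⟩).2 ⟨hat, le_rfl⟩
    rw [if_pos rfl] at h1
    by_contra hne
    have h3 : (η ⟨t, ht⟩ : ℕ) ≠ a := fun hc => hne (Fin.ext hc)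
    rw [hγ _ (by omega)] at h1
    omega
  have hγa : (γ ⟨a, by omega⟩ : ℕ) = p + 1 := by
    have h1 := hγη ⟨t, ht⟩ (by simp only; omega)
    rwa [hηt, if_pos rfl] at h1
  refine ⟨hκc, fun x => ?_, fun x => ?_⟩
  · by_cases h1 : (x : ℕ) = a
    · rw [if_pos h1, ← hγa]
      congr 2
      exact Fin.ext h1
    · by_cases h2 : p + 1 ≤ (x : ℕ) ∧ (x : ℕ) < a
      · have h3 := hγη x (by omega)
        rw [hη x (by omega)] at h3
        rw [h3]
        split_ifs <;> omega
      · rw [hγ x (by omega), if_neg h1, if_neg h2]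
  · by_cases h1 : (x : ℕ) = t
    · have : x = ⟨t, ht⟩ := Fin.ext h1
      rw [if_pos h1, this, hηt]
    · by_cases h2 : a ≤ (x : ℕ) ∧ (x : ℕ) < t
      · rw [if_neg h1, if_pos h2]
        have h3 := hγη x (by omega)
        rw [if_neg h1, if_pos h2.2] at h3
        have h4 := (hη.mem_iff x).2 ⟨h2.1, h2.2.le⟩
        by_cases h5 : (η x : ℕ) = a
        · have : η x = ⟨a, by omega⟩ := Fin.ext h5
          rw [this, hγa] at h3
          omega
        · rw [hγ _ (by omega)] at h3
          exact h3
      · rw [if_neg h1, if_neg h2, hη x (by omega)]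

theorem within_of_forall_ne {s t : ℕ} {σ : Perm (Fin N)}
    (h : ∀ x, σ x ≠ x → s ≤ (x : ℕ) ∧ (x : ℕ) ≤ t) : Within s t σ := by
  intro x hx
  by_contra hc
  have := h x hc
  omega

/-- Removing the last vertex of the open polygon splits a marked factorization into three. -/
theorem IsMarked.cut [NeZero N] {j s t : ℕ} {A B : List (Perm (Fin N))} {σ : Perm (Fin N)}
    (h : IsMarked (j + 1) s t A σ B) :
    ∃ p a, ∃ A₁ B₁ G H : List (Perm (Fin N)),
      IsMarked j s p A₁ (swap (pt s) (pt a) * σ) B₁ ∧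
      IsIntervalFactorization (p + 1) a G ∧ IsIntervalFactorization a t H ∧
      ((A₁ ++ G) ++ (H ++ B₁)).Perm (A ++ B) := by
  have hs := h.lt
  have hvs := val_pt hs
  have hst := h.fact.le
  have ht := h.fact.lt
  set b : Fin N := pt s with hb
  set a : Fin N := σ⁻¹ b with ha
  have hσa : σ a = b := by simp [ha]
  have hσb : σ b ≠ b := h.root.apply_ne
  have hab : a ≠ b := fun hc => hσb (by rw [← hc, hσa, hc])
  have hroot : IsRoot j b (swap b a * σ) := h.root.shrink
  have hw1 := h.root.weight
  have hw2 := hroot.weight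
  set c := (A ++ σ :: B).prod with hc
  have hcc : IsIntervalCycle s t c := h.fact.prod
  have hAw : Within s t A.prod := Within.list_prod fun τ hτ => h.within (by simp [hτ])
  have hAb : A.prod b = b := list_prod_apply_eq h.fix
  have hain : s ≤ (a : ℕ) ∧ (a : ℕ) ≤ t := by
    by_contra hcon
    have h1 : σ a = a := h.fact.within (by simp) a (by omega)
    exact hab (by rw [← hσa, h1])
  have habv : (a : ℕ) ≠ s := fun hcon => hab (Fin.ext (by omega))
  -- Carried past `A`, the transposition `(s a)` becomes `(s u)`, so the shortened product splits at
  -- `u`; hence `p = u - 1`.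
  set u : Fin N := A.prod a with hu
  have huin := (hAw.mem_iff a).2 hain
  rw [← hu] at huin
  have hus : (u : ℕ) ≠ s := fun hcon => hab (A.prod.injective (by
    rw [hAb, ← hu]; exact Fin.ext (by omega)))
  -- shortening the polygon separates `[s, u)` from `[u, t]`
  have hred1 : IsReduced (A ++ (swap b a * σ) :: B) :=
    h.fact.isReduced.swap_mul b a (by omega)
  have hprod1 : (A ++ (swap b a * σ) :: B).prod = swap b u * c := by
    have h1 : A.prod * swap b a = swap b u * A.prod := by
      rw [mul_swap_eq_swap_mul, hAb]
    simp only [hc, List.prod_append, List.prod_cons, ← mul_assoc]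
    rw [h1]
  have hval1 : ∀ x, ((swap b u * c) x : ℕ) = if (x : ℕ) + 1 = u then s else
      if (x : ℕ) = t then (u : ℕ) else
        if s ≤ (x : ℕ) ∧ (x : ℕ) < t then (x : ℕ) + 1 else x := by
    intro x
    have hx := hcc x
    rw [Perm.mul_apply]
    generalize c x = y at *
    simp only [swap_apply_def, Fin.ext_iff]
    split_ifs at hx ⊢ <;> omega
  have hpres1 : ∀ τ ∈ A ++ (swap b a * σ) :: B, ∀ x : Fin N,
      (s ≤ (τ x : ℕ) ∧ (τ x : ℕ) < u) ↔ (s ≤ (x : ℕ) ∧ (x : ℕ) < u) := fun τ hτ x =>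
    hred1.mem_iff (fun x : Fin N => s ≤ (x : ℕ) ∧ (x : ℕ) < u) (fun x => by
      rw [hprod1, hval1]
      split_ifs <;> omega) hτ x
  -- conjugating the factors to the right of the polygon separates `(s, a]` from its complement
  have hred2 : IsReduced (A ++ (swap b a * σ :: B).map fun τ => swap b a * τ * (swap b a)⁻¹) ∧
      (A ++ (swap b a * σ :: B).map fun τ => swap b a * τ * (swap b a)⁻¹).prod =
        c * swap b a := by
    have hp : (A ++ (swap b a * σ :: B).map fun τ => swap b a * τ * (swap b a)⁻¹).prod =
        c * swap b a := by
      rw [List.prod_append, prod_map_conj, hc, List.prod_append, List.prod_cons, List.prod_cons,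
        swap_inv, mul_assoc (swap b a) σ, swap_mul_self_mul]
      simp only [mul_assoc]
    refine ⟨?_, hp⟩
    have h1 := h.fact.isReduced
    unfold IsReduced at h1 ⊢
    rw [hp, mul_swap_eq_swap_mul]
    have h2 := finrank_invariants_swap_mul_le (c b) (c a) c
    rw [weightSum_append, weightSum_map_conj]
    rw [← hc] at h1
    simp only [weightSum_append, weightSum_cons] at h1 ⊢
    omega
  have hpres2 : ∀ τ ∈ A ++ (swap b a * σ :: B).map (fun τ => swap b a * τ * (swap b a)⁻¹),
      ∀ x : Fin N, (s < (τ x : ℕ) ∧ (τ x : ℕ) ≤ a) ↔ (s < (x : ℕ) ∧ (x : ℕ) ≤ a) :=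
    fun τ hτ x =>
    hred2.1.mem_iff (fun x : Fin N => s < (x : ℕ) ∧ (x : ℕ) ≤ a) (fun x => by
      have hx := hcc (swap b a x)
      rw [hred2.2, Perm.mul_apply, hx]
      generalize hy : swap b a x = y
      simp only [swap_apply_def, Fin.ext_iff] at hy
      have := x.2
      split_ifs at hy ⊢ <;> omega) hτ x
  -- Undoing the conjugation by `(s a)` turns `(s, a]` into `[s, a)`.
  have hpresB : ∀ τ ∈ B, ∀ x : Fin N,
      (s ≤ (τ x : ℕ) ∧ (τ x : ℕ) < a) ↔ (s ≤ (x : ℕ) ∧ (x : ℕ) < a) := by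
    intro τ hτ x
    have key : ∀ y : Fin N, (s < (swap b a y : ℕ) ∧ (swap b a y : ℕ) ≤ a) ↔
        (s ≤ (y : ℕ) ∧ (y : ℕ) < a) := by
      intro y
      simp only [swap_apply_def, Fin.ext_iff]
      split_ifs <;> omega
    have h1 := hpres2 (swap b a * τ * (swap b a)⁻¹)
      (List.mem_append_right _ (List.mem_map.2 ⟨τ, by simp [hτ], rfl⟩)) (swap b a x)
    simp only [swap_inv, Perm.mul_apply, swap_apply_self] at h1
    rwa [key, key] at h1
  have hua : (u : ℕ) ≤ a := by
    have := (list_prod_mem_iff (p := fun x : Fin N => s < (x : ℕ) ∧ (x : ℕ) ≤ a)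
      (F := A)
      (fun τ hτ x => hpres2 τ (List.mem_append_left _ hτ) x) a).2 (by omega)
    exact this.2
  -- A cycle lies entirely inside or outside each preserved set. Factors in `A` fix `s`, so the
  -- third interval can exclude `s`; for `B` the second cut falls before `a` instead of after it.
  have hAk : ∀ τ ∈ A, Within s (u - 1) τ ∨ Within u a τ ∨ Within (a + 1) t τ := by
    intro τ hτ
    have hcyc := h.isCycle τ (by simp [hτ])
    have hin : ∀ x, τ x ≠ x → s ≤ (x : ℕ) ∧ (x : ℕ) ≤ t := fun x hx => by
      by_contra hcon
      exact hx (h.within (by simp [hτ]) x (by omega))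
    have hns : ∀ x, τ x ≠ x → (x : ℕ) ≠ s := fun x hx hcon => hx (by
      rw [show x = b from Fin.ext (by omega)]; exact h.fix τ hτ)
    rcases IsCycle.forall_or_forall hcyc
      (fun x : Fin N => s ≤ (x : ℕ) ∧ (x : ℕ) < u) (hpres1 τ (by simp [hτ])) with h1 | h1
    · exact Or.inl (within_of_forall_ne fun x hx => by have := h1 x hx; omega)
    · rcases IsCycle.forall_or_forall hcyc
        (fun x : Fin N => s < (x : ℕ) ∧ (x : ℕ) ≤ a) (hpres2 τ (List.mem_append_left _ hτ)) with h2 | h2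
      · refine Or.inr (Or.inl (within_of_forall_ne fun x hx => ?_))
        have := h1 x hx; have := h2 x hx; have := hin x hx
        omega
      · refine Or.inr (Or.inr (within_of_forall_ne fun x hx => ?_))
        have := h2 x hx; have := hin x hx; have := hns x hx
        omega
  have hBk : ∀ τ ∈ B, Within s (u - 1) τ ∨ Within u (a - 1) τ ∨ Within a t τ := by
    intro τ hτ
    have hcyc := h.isCycle τ (by simp [hτ])
    have hin : ∀ x, τ x ≠ x → s ≤ (x : ℕ) ∧ (x : ℕ) ≤ t := fun x hx => by
      by_contra hcon
      exact hx (h.within (by simp [hτ]) x (by omega))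
    rcases IsCycle.forall_or_forall hcyc
      (fun x : Fin N => s ≤ (x : ℕ) ∧ (x : ℕ) < u) (hpres1 τ (by simp [hτ])) with h1 | h1
    · exact Or.inl (within_of_forall_ne fun x hx => by have := h1 x hx; omega)
    · rcases IsCycle.forall_or_forall hcyc
        (fun x : Fin N => s ≤ (x : ℕ) ∧ (x : ℕ) < a) (hpresB τ hτ) with h2 | h2
      · refine Or.inr (Or.inl (within_of_forall_ne fun x hx => ?_))
        have := h1 x hx; have := h2 x hx; have := hin x hx
        omega
      · refine Or.inr (Or.inr (within_of_forall_ne fun x hx => ?_))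
        have := h2 x hx; have := hin x hx
        omega
  have hσ1 : Within s (u - 1) (swap b a * σ) := by
    cases j with
    | zero => rw [isRoot_zero.1 hroot]; exact Within.one _ _
    | succ j =>
      rcases IsCycle.forall_or_forall hroot.isKCycle.1
        (fun x : Fin N => s ≤ (x : ℕ) ∧ (x : ℕ) < u)
        (hpres1 (swap b a * σ) (by simp)) with h1 | h1
      · exact within_of_forall_ne fun x hx => by have := h1 x hx; omega
      · exact absurd ⟨by omega, by omega⟩ (h1 b hroot.apply_ne)
  obtain ⟨A₁, A₂, A₃, hpA, hprodA, hA₁, hA₂, hA₃⟩ := exists_sorted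
    (Within s (u - 1)) (Within u a) (Within (a + 1) t)
    (fun σ τ h1 h2 => (h2.disjoint h1 (by omega)).commute.symm)
    (fun σ τ h1 h2 => (h2.disjoint h1 (by omega)).commute.symm)
    (fun σ τ h1 h2 => (h2.disjoint h1 (by omega)).commute.symm) A hAk
  obtain ⟨B₁, B₂, B₃, hpB, hprodB, hB₁, hB₂, hB₃⟩ := exists_sorted
    (Within s (u - 1)) (Within u (a - 1)) (Within a t)
    (fun σ τ h1 h2 => (h2.disjoint h1 (by omega)).commute.symm)
    (fun σ τ h1 h2 => (h2.disjoint h1 (by omega)).commute.symm)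
    (fun σ τ h1 h2 => (h2.disjoint h1 (by omega)).commute.symm) B hBk
  have wA₁ := Within.list_prod hA₁
  have wA₂ := Within.list_prod hA₂
  have wA₃ := Within.list_prod hA₃
  have wB₁ := Within.list_prod hB₁
  have wB₂ := Within.list_prod hB₂
  have wB₃ := Within.list_prod hB₃
  have hfac : (A₁ ++ (swap b a * σ) :: B₁).prod * (A₂ ++ B₂).prod * (A₃ ++ B₃).prod =
      swap b u * c := by
    rw [← hprod1]
    have c1 : Commute (swap b a * σ * B₁.prod) (A₂.prod * A₃.prod) :=
      ((hσ1.mul wB₁).disjoint wA₂ (by omega)).commute.mul_right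
        ((hσ1.mul wB₁).disjoint wA₃ (by omega)).commute
    have c2 : Commute B₂.prod A₃.prod := (wB₂.disjoint wA₃ (by omega)).commute
    simp only [List.prod_append, List.prod_cons]
    rw [hprodA, hprodB]
    calc A₁.prod * (swap b a * σ * B₁.prod) * (A₂.prod * B₂.prod) * (A₃.prod * B₃.prod)
        = A₁.prod * (swap b a * σ * B₁.prod) * A₂.prod * (B₂.prod * A₃.prod) * B₃.prod := by
          simp only [mul_assoc]
      _ = A₁.prod * ((swap b a * σ * B₁.prod) * (A₂.prod * A₃.prod)) * B₂.prod * B₃.prod := by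
          rw [c2.eq]; simp only [mul_assoc]
      _ = _ := by rw [c1.eq]; simp only [mul_assoc]
  have hu1 : (u : ℕ) - 1 + 1 = u := by omega
  obtain ⟨k1, k2, k3⟩ := isIntervalCycle_of_mul (s := s) (p := u - 1) (a := a) (t := t)
    (κ := (A₁ ++ (swap b a * σ) :: B₁).prod) (γ := (A₂ ++ B₂).prod) (η := (A₃ ++ B₃).prod)
    (by omega) (by omega) (by omega) ht
    (by rw [List.prod_append, List.prod_cons]; exact wA₁.mul (hσ1.mul wB₁))
    (by rw [List.prod_append, hu1]; exact wA₂.mul (wB₂.mono le_rfl (by omega)))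
    (by rw [List.prod_append]; exact (wA₃.mono (by omega) le_rfl).mul wB₃)
    (fun x => by
      rw [hfac, hval1]
      split_ifs <;> omega)
  -- The three lower bounds add up to `t - s - 1`, exactly the weight left after the polygon lost a
  -- vertex, so each bound is attained.
  have l1 := k1.le_weightSum (by omega) (by omega)
  have l2 := k2.le_weightSum (by omega) (by omega)
  have l3 := k3.le_weightSum (by omega) ht
  have hw := h.fact.weight
  have hwA := weightSum_perm hpA
  have hwB := weightSum_perm hpB
  simp only [weightSum_append, weightSum_cons] at l1 l2 l3 hw hwA hwB
  refine ⟨u - 1, a, A₁, B₁, A₂ ++ B₂, A₃ ++ B₃, ⟨⟨by omega, by omega, ?_, ?_⟩, ?_, ?_, ?_⟩,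
    ⟨by omega, a.2, k2, ?_⟩, ⟨by omega, ht, k3, ?_⟩, ?_⟩
  · rw [pt_val]; exact k1
  · rw [pt_val]
    simp only [weightSum_append, weightSum_cons]
    omega
  · intro τ hτ
    refine h.isCycle τ ?_
    have e1 := hpA.subset (a := τ)
    have e2 := hpB.subset (a := τ)
    simp only [List.mem_append] at hτ e1 e2 ⊢
    tauto
  · exact fun τ hτ => h.fix τ (hpA.subset (by simp [hτ]))
  · rw [pt_val]; exact hroot
  · rw [weightSum_append]; omega
  · rw [weightSum_append]; omega
  · refine List.Perm.trans ?_ (hpA.append hpB)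
    rw [← Multiset.coe_eq_coe]
    simp only [← Multiset.coe_add]
    abel

theorem exists_leftmost {α : Type*} {F : List (Perm α)} {a : α} (h : F.prod a ≠ a) :
    ∃ A σ B, F = A ++ σ :: B ∧ σ a ≠ a ∧ ∀ τ ∈ A, τ a = a := by
  induction F with
  | nil => exact absurd rfl h
  | cons σ F ih =>
    by_cases hσ : σ a = a
    · have hF : F.prod a ≠ a := fun hc => h (by
        rw [List.prod_cons, Perm.mul_apply, hc, hσ])
      obtain ⟨A, ρ, B, rfl, h1, h2⟩ := ih hF
      exact ⟨σ :: A, ρ, B, rfl, h1, by simpa using ⟨hσ, h2⟩⟩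
    · exact ⟨[], σ, F, rfl, hσ, by simp⟩

/-- Every marked factorization is, up to the order of its factors, encoded by a cactus. -/
theorem IsMarked.exists_cactus [NeZero N] (n : ℕ) : ∀ {j s t : ℕ} {A B : List (Perm (Fin N))}
    {σ : Perm (Fin N)}, IsMarked j s t A σ B → 2 * (t - s) + (1 - j) < n →
    ∃ T : Cactus j, s + T.size = t ∧ (T.eval s).2.1 = σ ∧
      ((T.eval s).1 ++ (T.eval s).2.2).Perm (A ++ B) := by
  induction n with
  -- In the measure `2 * (t - s) + (1 - j)`, opening a polygon keeps the interval and gains through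
  -- `1 - j`; cutting shortens every interval, and the factor 2 outweighs a return to `j = 0`.
  | zero => intro j s t A B σ _ hn; omega
  | succ n ih =>
    intro j s t A B σ h hn
    have hst := h.fact.le
    cases j with
    | zero =>
      have hσ := isRoot_zero.1 h.root
      subst hσ
      have hf : IsIntervalFactorization s t (A ++ B) := by
        obtain ⟨h1, h2, h3, h4⟩ := h.fact
        exact ⟨h1, h2, by simpa using h3, by simpa using h4⟩
      by_cases heq : s = t
      · subst heq
        have hnil : A ++ B = [] := by
          rw [List.eq_nil_iff_forall_not_mem]
          intro τ hτ
          obtain ⟨x, h1, h2, -⟩ := (hf.within hτ).exists_ne (h.isCycle τ hτ).ne_one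
          omega
        exact ⟨Cactus.nil, by simp, rfl, by rw [hnil]; exact List.Perm.refl _⟩
      · have hv := val_pt h.lt
        have hne : (A ++ B).prod (pt s) ≠ pt s := by
          intro hc
          have := hf.prod (pt s)
          rw [hc, hv, if_neg heq, if_pos (by omega)] at this
          omega
        obtain ⟨A', σ, B', hAB, hσ, hA'⟩ := exists_leftmost hne
        rw [hAB] at hf
        have hcyc := h.isCycle
        rw [hAB] at hcyc
        obtain ⟨j, hj⟩ := isRoot_of_isCycle (hcyc σ (by simp)) hσ
        have hm : IsMarked (j + 1) s t A' σ B' := ⟨hf, fun τ hτ => hcyc τ (by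
          simp only [List.mem_append, List.mem_cons] at hτ ⊢; tauto), hA', hj⟩
        obtain ⟨T, h1, h2, h3⟩ := ih hm (by omega)
        refine ⟨Cactus.close T, by rw [Cactus.size_close, h1], rfl, ?_⟩
        rw [hAB]
        simp only [Cactus.eval, List.nil_append]
        rw [h2]
        exact List.perm_middle.trans ((h3.cons σ).trans List.perm_middle.symm)
    | succ j =>
      obtain ⟨p, a, A₁, B₁, G, H, h1, hG, hH, hp⟩ := h.cut
      have hcyc : ∀ τ ∈ (A₁ ++ G) ++ (H ++ B₁), τ.IsCycle := fun τ hτ =>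
        h.isCycle τ (hp.subset hτ)
      have hsp := h1.fact.le
      have hpa := hG.le
      have hat := hH.le
      obtain ⟨T, hT1, hT2, hT3⟩ := ih h1 (by omega)
      obtain ⟨TG, hG1, -, hG3⟩ := ih (isMarked_zero.2 ⟨hG, fun τ hτ => hcyc τ (by simp [hτ])⟩)
        (by omega)
      obtain ⟨TH, hH1, -, hH3⟩ := ih (isMarked_zero.2 ⟨hH, fun τ hτ => hcyc τ (by simp [hτ])⟩)
        (by omega)
      rw [Cactus.eval_zero] at hG3 hH3
      have e1 : s + T.size + 1 = p + 1 := by omega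
      refine ⟨Cactus.ext T TG TH, by rw [Cactus.size_ext]; omega, ?_, ?_⟩
      · simp only [Cactus.eval]
        rw [e1, hG1, hT2, swap_mul_self_mul]
      · refine List.Perm.trans ?_ hp
        simp only [Cactus.eval]
        rw [e1, hG1, Cactus.eval_zero, Cactus.eval_zero]
        rw [← Multiset.coe_eq_coe] at hT3 hG3 hH3 ⊢
        simp only [← Multiset.coe_add, List.nil_append] at hT3 hG3 hH3 ⊢
        rw [hG3, hH3]
        have e : ∀ a b c d : Multiset (Perm (Fin N)), a + b + (c + d) = (a + d) + (b + c) := by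
          intro a b c d; abel
        rw [e, hT3]
        abel

/-! ### Cactuses as Łukasiewicz words -/

/-- `w` is the concatenation of `m` Łukasiewicz words, where `0` is a leaf and `j + 1` a node of
arity `2 * j + 3`. -/
def WordBalanced : ℕ → List ℕ → Prop
  | m, [] => m = 0
  | 0, _ :: _ => False
  | m + 1, 0 :: w => WordBalanced m w
  | m + 1, (j + 1) :: w => WordBalanced (m + 2 * j + 3) w

theorem wordBalanced_zero {w : List ℕ} : WordBalanced 0 w ↔ w = [] := by
  cases w <;> simp [WordBalanced]

/-- An open polygon with `j + 1` vertices carries two subtrees at each of its `j` non-root vertices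
and one at the root, so it counts as `2 * j + 1` trees. -/
theorem Cactus.wordBalanced_append {j : ℕ} (T : Cactus j) (m : ℕ) (w : List ℕ) :
    WordBalanced (m + (2 * j + 1)) (T.word ++ w) ↔ WordBalanced m w := by
  induction T generalizing m w with
  | nil => rfl
  | @close j T ih => exact ih m w
  | @ext j T G H ihT ihG ihH =>
    rw [word, List.append_assoc, List.append_assoc,
      show m + (2 * (j + 1) + 1) = (m + 2) + (2 * j + 1) by ring, ihT]
    exact (ihG (m + 1) _).trans (ihH m w)

theorem Cactus.word_ne_nil {j : ℕ} (T : Cactus j) : T.word ≠ [] := by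
  induction T with
  | nil => simp [word]
  | close T ih => simp [word]
  | ext T G H ihT ihG ihH => simp [word, ihT]

/-- Parsing: a leading letter `j + 1` shortens the word but raises the index `j`, so the induction
is on length first and on `j` inside. -/
theorem exists_word_append (n : ℕ) : ∀ (j m : ℕ) (w : List ℕ), w.length ≤ n →
    WordBalanced (m + (2 * j + 1)) w →
    ∃ (T : Cactus j) (w' : List ℕ), w = T.word ++ w' ∧ WordBalanced m w' := by
  induction n with
  | zero =>
    intro j m w hw h
    rw [List.length_eq_zero_iff.1 (Nat.le_zero.1 hw)] at h
    simp [WordBalanced] at h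
  | succ n ih =>
    intro j
    induction j with
    | zero =>
      intro m w hw h
      match w, h with
      | [], h => simp [WordBalanced] at h
      | 0 :: w, h => exact ⟨Cactus.nil, w, rfl, h⟩
      | (k + 1) :: w, h =>
        obtain ⟨T, w', rfl, h'⟩ := ih (k + 1) m w (by simpa using hw) h
        exact ⟨Cactus.close T, w', rfl, h'⟩
    | succ j ihj =>
      intro m w hw h
      rw [show m + (2 * (j + 1) + 1) = (m + 2) + (2 * j + 1) by ring] at h
      obtain ⟨T, w₁, rfl, h₁⟩ := ihj (m + 2) w hw h
      have hT := List.length_pos_iff.2 T.word_ne_nil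
      rw [List.length_append] at hw
      obtain ⟨G, w₂, rfl, h₂⟩ := ih 0 (m + 1) w₁ (by omega) h₁
      rw [List.length_append] at hw
      obtain ⟨H, w₃, rfl, h₃⟩ := ih 0 m w₂ (by omega) h₂
      exact ⟨Cactus.ext T G H, w₃, by simp [Cactus.word], h₃⟩

theorem Cactus.eq_of_word_append_eq {j : ℕ} (T T' : Cactus j) {w w' : List ℕ}
    (h : T.word ++ w = T'.word ++ w') : T = T' ∧ w = w' := by
  induction T generalizing w w' with
  | nil =>
    cases T' with
    | nil => simpa [word] using h
    | close T' => simp [word] at h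
  | @close j T ih =>
    cases T' with
    | nil => simp [word] at h
    | @close j' T' =>
      simp only [word, List.cons_append, List.cons.injEq, Nat.add_right_cancel_iff] at h
      obtain ⟨rfl, h⟩ := h
      obtain ⟨rfl, rfl⟩ := ih T' h
      exact ⟨rfl, rfl⟩
  | ext T G H ihT ihG ihH =>
    cases T' with
    | ext T' G' H' =>
      simp only [word, List.append_assoc] at h
      obtain ⟨rfl, hG⟩ := ihT T' h
      obtain ⟨rfl, hH⟩ := ihG G' hG
      obtain ⟨rfl, rfl⟩ := ihH H' hH
      exact ⟨rfl, rfl⟩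

/-! ### Counting words -/

/-- The balanced words with `e j` letters `j + 1` for every `j`. -/
def Words (m : ℕ) (e : ℕ →₀ ℕ) : Type :=
  {w : List ℕ // WordBalanced m w ∧ ∀ j, w.count (j + 1) = e j}

theorem words_zero_zero : Finite (Words 0 0) ∧ Nat.card (Words 0 0) = 1 := by
  have : Unique (Words 0 0) :=
    { default := ⟨[], rfl, by simp⟩
      uniq := fun w => Subtype.ext (wordBalanced_zero.1 w.2.1) }
  exact ⟨inferInstance, Nat.card_unique⟩

theorem words_zero {e : ℕ →₀ ℕ} (he : e ≠ 0) :
    Finite (Words 0 e) ∧ Nat.card (Words 0 e) = 0 := by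
  have : IsEmpty (Words 0 e) := ⟨fun w => he (Finsupp.ext fun j => by
    rw [← w.2.2 j, wordBalanced_zero.1 w.2.1]; rfl)⟩
  exact ⟨inferInstance, Nat.card_of_isEmpty⟩

theorem count_succ_cons_zero (w : List ℕ) (j : ℕ) : (0 :: w).count (j + 1) = w.count (j + 1) := by
  rw [List.count_cons, if_neg (by simp), add_zero]

theorem count_succ_cons_succ (w : List ℕ) (i j : ℕ) :
    ((i + 1) :: w).count (j + 1) = w.count (j + 1) + Finsupp.single i 1 j := by
  rw [List.count_cons, Finsupp.single_apply]
  simp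

/-- Balanced words are classified by their first letter. -/
theorem words_succ_equiv (m : ℕ) (e : ℕ →₀ ℕ) :
    Nonempty ((Words m e ⊕ Σ j : e.support,
      Words (m + 2 * (j : ℕ) + 3) (e - Finsupp.single (j : ℕ) 1)) ≃ Words (m + 1) e) := by
  let f : (Words m e ⊕ Σ j : e.support,
      Words (m + 2 * (j : ℕ) + 3) (e - Finsupp.single (j : ℕ) 1)) → Words (m + 1) e := fun x =>
    match x with
    | Sum.inl w => ⟨0 :: w.1, w.2.1, fun j => by rw [count_succ_cons_zero, w.2.2]⟩
    | Sum.inr ⟨i, w⟩ => ⟨(i + 1) :: w.1, w.2.1, fun j => by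
        rw [count_succ_cons_succ, w.2.2, Finsupp.tsub_apply]
        refine Nat.sub_add_cancel ?_
        rw [Finsupp.single_apply]
        split_ifs with h
        · have := Finsupp.mem_support_iff.1 i.2
          rw [h] at this
          omega
        · exact Nat.zero_le _⟩
  refine ⟨Equiv.ofBijective f ⟨?_, ?_⟩⟩
  · rintro (w | ⟨i, w⟩) (w' | ⟨i', w'⟩) h
    · have := congrArg Subtype.val h
      simp only [f, List.cons.injEq, true_and] at this
      exact congrArg _ (Subtype.ext this)
    · have := congrArg Subtype.val h
      simp [f] at this
    · have := congrArg Subtype.val h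
      simp [f] at this
    · have := congrArg Subtype.val h
      simp only [f, List.cons.injEq, Nat.add_right_cancel_iff] at this
      obtain ⟨h1, h2⟩ := this
      obtain rfl : i = i' := Subtype.ext h1
      obtain rfl : w = w' := Subtype.ext h2
      rfl
  · rintro ⟨w, hw, hc⟩
    match w, hw, hc with
    | [], hw, _ => simp [WordBalanced] at hw
    | 0 :: w, hw, hc =>
      exact ⟨Sum.inl ⟨w, hw, fun j => by rw [← hc, count_succ_cons_zero]⟩, rfl⟩
    | (i + 1) :: w, hw, hc =>
      have hi : i ∈ e.support := by
        rw [Finsupp.mem_support_iff, ← hc, count_succ_cons_succ, Finsupp.single_eq_same]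
        omega
      exact ⟨Sum.inr ⟨⟨i, hi⟩, ⟨w, hw, fun j => by
        rw [Finsupp.tsub_apply, ← hc, count_succ_cons_succ, Nat.add_sub_cancel]⟩⟩, rfl⟩

theorem prod_factorial_tsub_single {e : ℕ →₀ ℕ} {j : ℕ} (hj : j ∈ e.support) :
    (e.prod fun _ k => k.factorial) =
      e j * (e - Finsupp.single j 1).prod fun _ k => k.factorial := by
  have h0 := Finsupp.mem_support_iff.1 hj
  rw [← Finsupp.mul_prod_erase' e j _ (fun _ => rfl),
    ← Finsupp.mul_prod_erase' (e - Finsupp.single j 1) j _ (fun _ => rfl), ← mul_assoc]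
  congr 1
  · rw [Finsupp.tsub_apply, Finsupp.single_eq_same, Nat.mul_factorial_pred h0]
  · congr 1
    ext i
    by_cases hi : i = j
    · simp [hi]
    · simp [Finsupp.erase_ne hi, Ne.symm hi]

theorem sum_tsub_single {e : ℕ →₀ ℕ} {j : ℕ} (hj : j ∈ e.support) (c : ℕ → ℕ) :
    (e.sum fun i k => c i * k) = ((e - Finsupp.single j 1).sum fun i k => c i * k) + c j := by
  have h0 := Finsupp.mem_support_iff.1 hj
  have he : e = (e - Finsupp.single j 1) + Finsupp.single j 1 := by
    refine (tsub_add_cancel_of_le ?_).symm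
    rw [Finsupp.single_le_iff]
    omega
  conv_lhs => rw [he]
  rw [Finsupp.sum_add_index' (by simp) (by intros; ring), Finsupp.sum_single_index (by simp),
    mul_one]

/-- The number of balanced words with given letters. -/
theorem card_words (n : ℕ) : ∀ (m : ℕ) (e : ℕ →₀ ℕ),
    m + (e.sum fun j k => (2 * j + 2) * k) + (e.sum fun _ k => 1 * k) ≤ n →
    Finite (Words m e) ∧ (1 ≤ m →
      Nat.card (Words m e) * ((m + e.sum fun j k => (2 * j + 2) * k).factorial *
        e.prod fun _ k => k.factorial) =
      m * (m + (e.sum fun j k => (2 * j + 2) * k) + (e.sum fun _ k => 1 * k) - 1).factorial) := by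
  -- The bounded quantity is the word length, which drops by one with the first letter. The
  -- restriction `1 ≤ m` is needed because the empty word contradicts the formula at `m = 0`, `e =
  -- 0`.
  induction n with
  | zero =>
    intro m e h
    obtain rfl : m = 0 := by omega
    refine ⟨?_, by omega⟩
    by_cases he : e = 0
    · rw [he]; exact words_zero_zero.1
    · exact (words_zero he).1
  | succ n ih =>
    intro m e h
    cases m with
    | zero =>
      refine ⟨?_, by omega⟩
      by_cases he : e = 0
      · rw [he]; exact words_zero_zero.1
      · exact (words_zero he).1
    | succ m =>
      have ih1 := ih m e (by omega)
      have ih2 : ∀ j : e.support, _ := fun j =>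
        ih (m + 2 * (j : ℕ) + 3) (e - Finsupp.single (j : ℕ) 1) (by
          have h1 := sum_tsub_single j.2 fun i => 2 * i + 2
          have h2 := sum_tsub_single j.2 fun _ => 1
          omega)
      have := ih1.1
      have : ∀ j : e.support, Finite
        (Words (m + 2 * (j : ℕ) + 3) (e - Finsupp.single (j : ℕ) 1)) := fun j => (ih2 j).1
      obtain ⟨eqv⟩ := words_succ_equiv m e
      refine ⟨Finite.of_equiv _ eqv, fun _ => ?_⟩
      rw [← Nat.card_congr eqv, Nat.card_sum, Nat.card_sigma]
      set S := e.sum fun j k => (2 * j + 2) * k with hS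
      set R := e.sum fun _ k => 1 * k with hR
      set P := e.prod fun _ k => k.factorial with hP
      by_cases he : m = 0 ∧ e = 0
      · obtain ⟨rfl, rfl⟩ := he
        have : IsEmpty (0 : ℕ →₀ ℕ).support := by
          rw [Finsupp.support_zero]; infer_instance
        simp [hS, hR, hP, words_zero_zero.2]
      have hpos : 1 ≤ m + S + R := by
        by_contra hc
        refine he ⟨by omega, ?_⟩
        have hR0 : R = 0 := by omega
        rw [hR, Finsupp.sum, Finset.sum_eq_zero_iff] at hR0
        ext j
        by_contra hj
        have := hR0 j (Finsupp.mem_support_iff.2 hj)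
        simp only [one_mul] at this
        exact hj this
      have e1 : Nat.card (Words m e) * ((m + 1 + S).factorial * P) =
          (m + 1 + S) * m * (m + S + R - 1).factorial := by
        rcases Nat.eq_zero_or_pos m with rfl | hm
        · rw [(words_zero fun hc => he ⟨rfl, hc⟩).2]; simp
        · rw [show m + 1 + S = (m + S) + 1 by ring, Nat.factorial_succ]
          have := ih1.2 hm
          calc _ = (m + S + 1) * (Nat.card (Words m e) * ((m + S).factorial * P)) := by ring
            _ = _ := by rw [this]; ring
      have e2 : ∀ j : e.support,
          Nat.card (Words (m + 2 * (j : ℕ) + 3) (e - Finsupp.single (j : ℕ) 1)) *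
            ((m + 1 + S).factorial * P) =
          ((2 * (j : ℕ) + 2) * e j + (m + 1) * (1 * e j)) * (m + S + R - 1).factorial := by
        intro j
        have h1 := sum_tsub_single j.2 fun i => 2 * i + 2
        have h2 := sum_tsub_single j.2 fun _ => 1
        have h3 := (ih2 j).2 (by omega)
        rw [← hS] at h1
        rw [← hR] at h2
        rw [hP, prod_factorial_tsub_single j.2]
        generalize ((e - Finsupp.single (j : ℕ) 1).sum fun i k => (2 * i + 2) * k) = S' at *
        generalize ((e - Finsupp.single (j : ℕ) 1).sum fun _ k => 1 * k) = R' at *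
        rw [show m + 2 * (j : ℕ) + 3 + S' = m + 1 + S by omega,
          show m + 1 + S + R' - 1 = m + S + R - 1 by omega] at h3
        generalize ((e - Finsupp.single (j : ℕ) 1).prod fun _ k => k.factorial) = P' at *
        calc _ = e j * (Nat.card (Words (m + 2 * (j : ℕ) + 3) (e - Finsupp.single (j : ℕ) 1)) *
              ((m + 1 + S).factorial * P')) := by ring
          _ = _ := by rw [h3]; ring
      -- Summing over first letters leaves `(m+1+S) m + S + (m+1) R = (m+1)(m+S+R)`.
      rw [add_mul, e1, Finset.sum_mul, Finset.sum_congr rfl fun j _ => e2 j, ← Finset.sum_mul,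
        Finset.sum_add_distrib, ← Finset.mul_sum,
        Finset.sum_coe_sort e.support fun j => (2 * j + 2) * e j,
        Finset.sum_coe_sort e.support fun j => 1 * e j]
      change _ + (S + (m + 1) * R) * _ = _
      rw [← add_mul, show m + 1 + S + R - 1 = (m + S + R - 1) + 1 by omega, Nat.factorial_succ,
        ← mul_assoc]
      congr 1
      rw [show m + S + R - 1 + 1 = m + S + R by omega]
      ring

/-! ### Factorizations of the full cycle -/

theorem isIntervalCycle_finRotate {n : ℕ} (hn : 1 ≤ n) :
    IsIntervalCycle 0 (n - 1) (finRotate n) := by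
  obtain ⟨k, rfl⟩ : ∃ k, n = k + 1 := ⟨n - 1, by omega⟩
  intro x
  rw [finRotate_apply, Fin.val_add_one]
  have := x.2
  simp only [Fin.ext_iff, Fin.val_last]
  split_ifs <;> omega

theorem numCycles_eq (σ : Perm (Fin N)) :
    numCycles σ = σ.cycleType.card + (N - σ.support.card) := by
  rw [numCycles, Perm.parts_partition, Multiset.card_add, Multiset.card_replicate,
    Fintype.card_fin]

theorem numCycles_add_weight {σ : Perm (Fin N)} (h : σ.IsCycle) :
    numCycles σ + weight σ = N := by
  have h1 := h.two_le_card_support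
  have h2 := Finset.card_le_univ σ.support
  rw [Fintype.card_fin] at h2
  rw [numCycles_eq, h.cycleType, Multiset.card_singleton, weight]
  omega

theorem numCycles_finRotate {n : ℕ} (hn : 1 ≤ n) : numCycles (finRotate n) = 1 := by
  rcases Nat.eq_or_lt_of_le hn with rfl | h
  · rw [numCycles_eq, show finRotate 1 = 1 from Subsingleton.elim _ _]
    simp
  · obtain ⟨k, rfl⟩ : ∃ k, n = k + 2 := ⟨n - 2, by omega⟩
    rw [numCycles_eq, isCycle_finRotate.cycleType, support_finRotate]
    simp

theorem sum_numCycles_add_weightSum {F : List (Perm (Fin N))} (h : ∀ τ ∈ F, τ.IsCycle) :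
    (F.map numCycles).sum + weightSum F = N * F.length := by
  induction F with
  | nil => simp
  | cons σ F ih =>
    have h1 := ih fun τ hτ => h τ (by simp [hτ])
    have h2 := numCycles_add_weight (h σ (by simp))
    rw [List.map_cons, List.sum_cons, weightSum_cons, List.length_cons, Nat.mul_succ]
    omega

theorem isPretransitive_of_prod_eq {n : ℕ} (hn : 1 ≤ n) {F : List (Perm (Fin n))}
    (h : F.prod = finRotate n) :
    MulAction.IsPretransitive (Subgroup.closure {σ | σ ∈ F}) (Fin n) := by
  have hm : finRotate n ∈ Subgroup.closure {σ | σ ∈ F} := by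
    rw [← h]
    exact Subgroup.list_prod_mem _ fun σ hσ => Subgroup.subset_closure hσ
  refine ⟨fun x y => ?_⟩
  obtain ⟨i, hi⟩ : ∃ i : ℕ, (finRotate n ^ i) x = y := by
    rcases Nat.eq_or_lt_of_le hn with rfl | h1
    · exact ⟨0, Subsingleton.elim _ _⟩
    · obtain ⟨k, rfl⟩ : ∃ k, n = k + 2 := ⟨n - 2, by omega⟩
      have hmv : ∀ z, finRotate (k + 2) z ≠ z := fun z => by
        rw [← Perm.mem_support, support_finRotate]; simp
      exact Perm.IsCycle.exists_pow_eq isCycle_finRotate (hmv x) (hmv y)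
  exact ⟨⟨finRotate n ^ i, Subgroup.pow_mem _ hm i⟩, hi⟩

/-- For a cycle the weight is `n` minus the number of cycles, so the minimality equation says that
the total weight is `n - 1`. Transitivity is automatic, since the product alone is transitive. -/
theorem isCycleFactorization_finRotate {n : ℕ} (hn : 1 ≤ n) {F : List (Perm (Fin n))} :
    IsCycleFactorization (finRotate n) F ↔
      IsIntervalFactorization 0 (n - 1) F ∧ ∀ τ ∈ F, τ.IsCycle := by
  have h1 := numCycles_finRotate hn
  constructor
  · intro h
    have h2 := sum_numCycles_add_weightSum h.isCycle
    have h3 := h.minimal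
    refine ⟨⟨Nat.zero_le _, by omega, ?_, ?_⟩, h.isCycle⟩
    · rw [h.prod_eq]; exact isIntervalCycle_finRotate hn
    · rw [h1] at h3
      zify at h2 ⊢
      push_cast [hn] at h3 ⊢
      linarith
  · rintro ⟨h, hc⟩
    have h2 := sum_numCycles_add_weightSum hc
    have h3 := h.weight
    have hp := h.prod.unique (isIntervalCycle_finRotate hn)
    refine ⟨⟨⟨hp, isPretransitive_of_prod_eq hn hp⟩, ?_⟩, hc⟩
    rw [h1]
    zify [hn] at h2 h3
    push_cast
    linarith

-- Only closed polygons count on either side: the open one is left out of the factor list, and its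
-- letter is written when it is closed.
open Classical in
theorem Cactus.countP_eval [NeZero N] {j : ℕ} (T : Cactus j) (s : ℕ) (h : s + T.size < N)
    (k : ℕ) :
    ((T.eval s).1 ++ (T.eval s).2.2 : List (Perm (Fin N))).countP
      (fun σ => decide (IsKCycle (k + 2) σ)) = T.word.count (k + 1) := by
  induction T generalizing s with
  | nil => simp [eval, word]
  | @close j T ih =>
    rw [size_close] at h
    have h1 := (T.isMarked (N := N) s h).root.isKCycle
    have h2 := ih s h
    rw [List.countP_append] at h2
    simp only [eval, List.nil_append, word]
    rw [List.countP_append, List.countP_cons, List.count_cons, ← h2, ← add_assoc]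
    congr 1
    by_cases hk : j = k
    · subst hk
      simp [h1]
    · have : ¬ IsKCycle (k + 2) ((T.eval s).2.1 : Perm (Fin N)) := fun hc => hk (by
        have := h1.2.symm.trans hc.2
        omega)
      simp [this, hk]
  | ext T G H ihT ihG ihH =>
    rw [size_ext] at h
    have e1 := ihT s (by omega)
    have e2 := ihG (s + T.size + 1) (by omega)
    have e3 := ihH (s + T.size + 1 + G.size) (by omega)
    rw [eval_zero] at e2 e3
    simp only [eval, word]
    rw [eval_zero, eval_zero]
    simp only [List.countP_append, List.count_append, List.countP_nil] at *
    omega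

theorem sum_eq_of_count (w : List ℕ) : ∀ (e : ℕ →₀ ℕ), (∀ j, w.count (j + 1) = e j) →
    w.sum = e.sum fun j k => (j + 1) * k := by
  induction w with
  | nil =>
    intro e h
    obtain rfl : e = 0 := Finsupp.ext fun j => by rw [← h j]; rfl
    simp
  | cons a w ih =>
    intro e h
    cases a with
    | zero =>
      rw [List.sum_cons, zero_add]
      exact ih e fun j => by rw [← h, count_succ_cons_zero]
    | succ i =>
      have hi : i ∈ e.support := by
        rw [Finsupp.mem_support_iff, ← h, count_succ_cons_succ, Finsupp.single_eq_same]
        omega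
      rw [List.sum_cons, sum_tsub_single hi, ih (e - Finsupp.single i 1) fun j => by
        rw [Finsupp.tsub_apply, ← h, count_succ_cons_succ, Nat.add_sub_cancel], add_comm]

theorem Cactus.wordBalanced (T : Cactus 0) : WordBalanced 1 T.word := by
  have := (T.wordBalanced_append 0 []).2 rfl
  simpa using this

theorem exists_word_eq {w : List ℕ} (h : WordBalanced 1 w) : ∃ T : Cactus 0, T.word = w := by
  obtain ⟨T, w', rfl, hw⟩ := exists_word_append w.length 0 0 w le_rfl h
  rw [wordBalanced_zero] at hw
  exact ⟨T, by simp [hw]⟩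

/-- Every cycle factorization of `finRotate n` is equivalent to one encoded by a cactus. -/
theorem exists_cactus_equivalent {n : ℕ} [NeZero n] {i : ℕ →₀ ℕ}
    (F : Factorizations (finRotate n) i) :
    ∃ T : Cactus 0, T.size = n - 1 ∧ (∀ j, T.word.count (j + 1) = i (j + 2)) ∧
      Equivalent (T.factors n 0) F.1 := by
  obtain ⟨F, hF, hi⟩ := F
  have hn : 1 ≤ n := Nat.one_le_iff_ne_zero.2 (NeZero.ne n)
  rw [isCycleFactorization_finRotate hn] at hF
  obtain ⟨T, h1, -, h3⟩ := (isMarked_zero.2 hF).exists_cactus _ (Nat.lt_succ_self _)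
  rw [zero_add] at h1
  refine ⟨T, h1, fun j => ?_, ?_⟩
  · rw [← T.countP_eval (N := n) 0 (by omega) j, h3.countP_eq]
    exact hi (j + 2) (by omega)
  · have hT := T.isIntervalFactorization (N := n) 0 (by omega)
    rw [zero_add, h1] at hT
    rw [Cactus.eval_zero] at h3
    exact hT.1.equivalent hF.1 (fun σ hσ => (hT.2 σ hσ).ne_one) h3

/-- The factorization encoded by a cactus, as a cycle factorization of `finRotate n`. -/
def Cactus.toFactorization {n : ℕ} [NeZero n] {i : ℕ →₀ ℕ} (T : Cactus 0)
    (hs : T.size = n - 1) (hc : ∀ j, T.word.count (j + 1) = i (j + 2)) :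
    Factorizations (finRotate n) i :=
  ⟨T.factors n 0, by
    have hn : 1 ≤ n := Nat.one_le_iff_ne_zero.2 (NeZero.ne n)
    refine ⟨(isCycleFactorization_finRotate hn).2 ?_, fun k hk => ?_⟩
    · have := T.isIntervalFactorization (N := n) 0 (by omega)
      rwa [zero_add, hs] at this
    · obtain ⟨j, rfl⟩ : ∃ j, k = j + 2 := ⟨k - 2, by omega⟩
      have := T.countP_eval (N := n) 0 (by omega) j
      rw [eval_zero, hc] at this
      exact this⟩

/-- If the numbers of polygons fit, classes of factorizations correspond to balanced words. -/
theorem words_equiv_classes {n : ℕ} [NeZero n] {i e : ℕ →₀ ℕ} (he : ∀ j, e j = i (j + 2))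
    (h : (e.sum fun j k => (j + 1) * k) = n - 1) :
    Nonempty (Words 1 e ≃ Classes (finRotate n) i) := by
  have hn : 1 ≤ n := Nat.one_le_iff_ne_zero.2 (NeZero.ne n)
  choose T hT using fun w : Words 1 e => exists_word_eq w.2.1
  have hs : ∀ w, (T w).size = n - 1 := fun w => by
    rw [Cactus.size, zero_add, hT, sum_eq_of_count w.1 e w.2.2, h]
  have hc : ∀ w j, (T w).word.count (j + 1) = i (j + 2) := fun w j => by
    rw [hT, w.2.2, he]
  let f : Words 1 e → Classes (finRotate n) i := fun w =>
    Quotient.mk (factorizationSetoid (finRotate n) i) ((T w).toFactorization (hs w) (hc w))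
  refine ⟨Equiv.ofBijective f ⟨?_, ?_⟩⟩
  · intro w w' hw
    have h1 : Equivalent ((T w).factors n 0) ((T w').factors n 0) := Quotient.exact hw
    have h2 : T w = T w' := Cactus.eq_of_eval_perm (N := n) _ _ 0
      (by rw [hs]; omega) (by rw [hs]; omega) (by rw [Cactus.eval_zero, Cactus.eval_zero])
      (by rw [Cactus.eval_zero, Cactus.eval_zero]; exact h1.perm)
    exact Subtype.ext (by rw [← hT w, ← hT w', h2])
  · intro q
    obtain ⟨F, rfl⟩ := Quotient.exists_rep q
    obtain ⟨T', h1, h2, h3⟩ := exists_cactus_equivalent F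
    let w : Words 1 e := ⟨T'.word, T'.wordBalanced, fun j => by rw [h2, he]⟩
    have hw : T w = T' := (Cactus.eq_of_word_append_eq (T w) T' (w := []) (w' := [])
      (by rw [hT])).1
    refine ⟨w, Quotient.sound ?_⟩
    change Equivalent ((T w).factors n 0) F.1
    rw [hw]
    exact h3

theorem isEmpty_classes {n : ℕ} [NeZero n] {i e : ℕ →₀ ℕ} (he : ∀ j, e j = i (j + 2))
    (h : (e.sum fun j k => (j + 1) * k) ≠ n - 1) : IsEmpty (Classes (finRotate n) i) := by
  refine ⟨fun q => ?_⟩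
  obtain ⟨F, rfl⟩ := Quotient.exists_rep q
  obtain ⟨T, h1, h2, -⟩ := exists_cactus_equivalent F
  rw [Cactus.size, zero_add, sum_eq_of_count T.word e fun j => by rw [h2, he]] at h1
  exact h h1

end CycleFactorization

/-- `finRotate n` is the full cycle `(1 2 … n)`, the `n` symbols being the elements of `Fin n`. -/
theorem theorem4 (n : ℕ) (hn : 1 ≤ n) (i : ℕ →₀ ℕ) (hi : ∀ k < 2, i k = 0)
    (r : ℕ) (hr : r = i.sum fun _ m => m) :
    Finite (CycleFactorization.Classes (finRotate n) i) ∧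
    (Nat.card (CycleFactorization.Classes (finRotate n) i) : ℚ) =
      if n + r - 1 = i.sum (fun k m => k * m) then
        ((2 * n + r - 2).factorial : ℚ) /
          ((2 * n - 1).factorial * i.prod (fun _ m => (m.factorial : ℚ)))
      else 0 := by
  have : NeZero n := ⟨by omega⟩
  -- The letter `j + 1` stands for a `(j + 2)`-cycle, of weight `j + 1`, whence the shift by 2.
  let e : ℕ →₀ ℕ := i.comapDomain (· + 2) (add_left_injective 2).injOn
  have he : ∀ j, e j = i (j + 2) := fun j => rfl
  have hie : i = e.embDomain (addRightEmbedding 2) := by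
    ext k
    match k with
    | 0 => rw [hi 0 (by omega), Finsupp.embDomain_of_notMem_range]; simp
    | 1 => rw [hi 1 (by omega), Finsupp.embDomain_of_notMem_range]; simp
    | j + 2 => exact (Finsupp.embDomain_apply_self (addRightEmbedding 2) e j).symm
  have hR : r = e.sum fun _ k => 1 * k := by
    rw [hr, hie, Finsupp.sum_embDomain]; simp
  have hD : (i.sum fun k m => k * m) = (e.sum fun j k => (j + 1) * k) + r := by
    rw [hR, ← Finsupp.sum_add]
    conv_lhs => rw [hie]
    rw [Finsupp.sum_embDomain]
    refine Finsupp.sum_congr fun j _ => ?_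
    simp only [addRightEmbedding_apply]
    ring
  have hS : (e.sum fun j k => (2 * j + 2) * k) = 2 * e.sum fun j k => (j + 1) * k := by
    rw [Finsupp.mul_sum]
    exact Finsupp.sum_congr fun j _ => by ring
  have hP : (i.prod fun _ m => (m.factorial : ℚ)) =
      ((e.prod fun _ k => k.factorial : ℕ) : ℚ) := by
    conv_lhs => rw [hie]
    rw [Finsupp.prod_embDomain]
    simp [Finsupp.prod]
  by_cases hc : (e.sum fun j k => (j + 1) * k) = n - 1
  · obtain ⟨eqv⟩ := CycleFactorization.words_equiv_classes he hc
    obtain ⟨hfin, hcard⟩ := CycleFactorization.card_words _ 1 e le_rfl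
    refine ⟨Finite.of_equiv _ eqv, ?_⟩
    have h1 := hcard le_rfl
    rw [hS, hc, ← hR, show 1 + 2 * (n - 1) = 2 * n - 1 by omega,
      show 2 * n - 1 + r - 1 = 2 * n + r - 2 by omega, one_mul] at h1
    rw [if_pos (by omega), ← Nat.card_congr eqv, hP, eq_div_iff]
    · exact_mod_cast h1
    · have h2 : (e.prod fun _ k => k.factorial) ≠ 0 :=
        Finset.prod_ne_zero_iff.2 fun j _ => Nat.factorial_ne_zero _
      exact_mod_cast mul_ne_zero (Nat.factorial_ne_zero _) h2
  · have := CycleFactorization.isEmpty_classes he hc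
    refine ⟨inferInstance, ?_⟩
    rw [if_neg (by omega), Nat.card_of_isEmpty, Nat.cast_zero]
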